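/- Let $K$ be a field, let $G$ be a finite simple graph and let $B$ be a block of $G$, i.e. an induced subgraph of $G$ that is maximal among the connected induced subgraphs without cut vertices. (A cut vertex of a graph is a vertex whose deletion increases the number of connected components.) Let $W\subseteq V(B)$ be any set of vertices of $B$, and let $\overline{B}$ be the graph obtained from $B$ by adding, for each $w\in W$, one new vertex $f_w$ and the single edge $\{w,f_w\}$; for instance, $W$ may be the set of all cut vertices of $G$ that lie in $B$. For a finite simple graph $H$ let $J_H=(x_iy_j-x_jy_i : \{i,j\}\in E(H))\subseteq K[x_v,y_v : v\in V(H)]$ be its binomial edge ideal; $J_H$ is called unmixed if all its minimal primes have the same height. A set $T\subseteq V(H)$ is a cutset of $H$ if each $t\in T$ is a cut vertex of $H\setminus(T\setminus\{t\})$. The graph $H$ is called accessible if $J_H$ is unmixed and every non-empty cutset $T$ of $H$ contains some $t$ such that $T\setminus\{t\}$ is again a cutset of $H$. If $\overline{B}$ is accessible and has exactly three cut vertices, then there is a cut vertex $v$ of $\overline{B}$ such that $J_{\overline{B}\setminus\{v\}}$ is unmixed. -/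

import Mathlib

/-!
Binomial edge ideals, unmixedness, cutsets, accessible graphs and blocks with whiskers.
All graphs are simple; the theorem uses these notions for finite graphs only.
-/

namespace BinomialEdge

/-- The binomial edge ideal `J_G = (x_i y_j - x_j y_i : {i, j} an edge of G)` in the polynomial ring
`K[x_v, y_v : v ∈ V(G)]`, where `x_v = X (Sum.inl v)` and `y_v = X (Sum.inr v)`.  As
`f_{ji} = -f_{ij}`, taking both orientations of each edge does not change the ideal. -/
noncomputable def binomialEdgeIdeal (K : Type*) [Field K] {V : Type*} (G : SimpleGraph V) :
    Ideal (MvPolynomial (V ⊕ V) K) :=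
  Ideal.span {f | ∃ i j : V, G.Adj i j ∧
    f = MvPolynomial.X (Sum.inl i) * MvPolynomial.X (Sum.inr j)
      - MvPolynomial.X (Sum.inl j) * MvPolynomial.X (Sum.inr i)}

/-- An ideal is unmixed if all its minimal primes have the same height. -/
def IsUnmixed {R : Type*} [CommRing R] (I : Ideal R) : Prop :=
  ∀ P ∈ I.minimalPrimes, ∀ Q ∈ I.minimalPrimes, P.height = Q.height

/-- The graph `G ∖ T`, that is, the subgraph of `G` induced on the complement of `T`. -/
abbrev deleteSet {V : Type*} (G : SimpleGraph V) (T : Set V) : SimpleGraph ↥Tᶜ :=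
  G.induce Tᶜ

/-- `c_G(T)`: the number of connected components of `G ∖ T` (for finite `G`). -/
noncomputable def numComponents {V : Type*} (G : SimpleGraph V) (T : Set V) : ℕ :=
  Nat.card (deleteSet G T).ConnectedComponent

/-- `v` is a cut vertex of `G`: deleting `v` increases the number of connected components. -/
def IsCutVertex {V : Type*} (G : SimpleGraph V) (v : V) : Prop :=
  Nat.card G.ConnectedComponent < Nat.card (deleteSet G {v}).ConnectedComponent

/-- `T` is a cutset of `G`: every `t ∈ T` is a cut vertex of `G ∖ (T ∖ {t})`.  Deleting `t` from
`G ∖ (T ∖ {t})` leaves `G ∖ T`, so this says `c_G(T ∖ {t}) < c_G(T)`. -/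
def IsCutset {V : Type*} (G : SimpleGraph V) (T : Set V) : Prop :=
  ∀ t ∈ T, numComponents G (T \ {t}) < numComponents G T

/-- `G` is accessible (over `K`): `J_G` is unmixed, and every non-empty cutset `T` of `G` has an
element `t` such that `T ∖ {t}` is again a cutset. -/
def IsAccessible (K : Type*) [Field K] {V : Type*} (G : SimpleGraph V) : Prop :=
  IsUnmixed (binomialEdgeIdeal K G) ∧
    ∀ T : Set V, IsCutset G T → T.Nonempty → ∃ t ∈ T, IsCutset G (T \ {t})

/-- `S` is the vertex set of a block of `G`: the induced subgraph `G[S]` is connected and has no cut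
vertex, and `S` is maximal with this property. -/
def IsBlock {V : Type*} (G : SimpleGraph V) (S : Set V) : Prop :=
  Maximal (fun S' : Set V => (G.induce S').Connected ∧ ∀ v, ¬ IsCutVertex (G.induce S') v) S

/-- The graph obtained from `B` by attaching to each `w ∈ W` one whisker `{w, f_w}`, where
`f_w = Sum.inr w` is a new vertex. -/
def withWhiskers {V : Type*} (B : SimpleGraph V) (W : Set V) : SimpleGraph (V ⊕ ↥W) where
  Adj a b := match a, b with
    | Sum.inl u, Sum.inl v => B.Adj u v
    | Sum.inl u, Sum.inr w => u = w
    | Sum.inr w, Sum.inl u => u = w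
    | Sum.inr _, Sum.inr _ => False
  symm := ⟨by
    rintro (u | w) (v | w') h
    · exact SimpleGraph.Adj.symm h
    · exact h
    · exact h
    · exact h⟩
  loopless := ⟨by
    rintro (u | w) h
    · exact B.loopless.irrefl u h
    · exact h⟩

end BinomialEdge

/-! The minimal primes of `J_G` are the ideals `P_T` of the cutsets `T`, and `P_T` has height `|V| +
|T| - c(T)`. Unmixedness therefore means `c(T) = |T| + c(∅)` for every cutset `T`, and the problem
becomes combinatorial. For whiskers at `W` on a connected graph `B` without cut vertices, cutsets
are subsets of `B` (`IsWhiskerCutset`), and the condition reads `c(B ∖ T) = |T ∖ W| + 1`.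

Delete the whiskered vertex `w`. If a cutset `T` of the smaller graph leaves `w` a neighbour in `B`,
then `T ∪ {w}` is a cutset of the original graph, and its component count is the required one.
Unmixedness can only fail through an obstruction, that is, a cutset of the smaller graph containing
all neighbours of `w` in `B`. The core of the proof, `exists_forall_not_isObstruction`, shows that
when `|W| = 3` some `w ∈ W` has no obstruction.

Suppose all three vertices have one. Accessibility gives every vertex a neighbour in `W`, so some `m
∈ W` is adjacent to the other two, `a` and `b`. It also allows the obstruction of `a` to be stripped
down to a cutset with a single vertex `y` outside `W`. By `pendant_or_pocket`, either `b` has at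
most one neighbour besides `m`, or a pocket `F` free of `W` hangs on `b`, `m` and `y`. A smallest
pocket contains no further cutset of this kind. Counting components then bounds `|F ∩ T|` by `|F ∖
T|` for the obstructions `T` of both `b` and `m`, strictly for `m`. Since every vertex of `F` is
adjacent to `b` or `m`, these bounds contradict each other (`isPendantAt_of_isPocket`). So `a` and
`b` are both pendant at `m`, and stripping the obstruction of `m` leaves a configuration small
enough to refute directly. -/

namespace BinomialEdge

/-! ### Separation of vertices, component counts and cutsets -/

section Separation

variable {V : Type*} {G : SimpleGraph V} {T : Set V}

/-- The vertices `a` and `b` lie outside `T` and in different components of `G ∖ T`: some set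
contains `a` but not `b`, and is closed under adjacency outside `T`. -/
def Sep (G : SimpleGraph V) (T : Set V) (a b : V) : Prop :=
  a ∉ T ∧ b ∉ T ∧ ∃ K : Set V, a ∈ K ∧ b ∉ K ∧ ∀ x ∈ K, ∀ y, G.Adj x y → y ∈ K ∨ y ∈ T

lemma Sep.symm {a b : V} (h : Sep G T a b) : Sep G T b a := by
  obtain ⟨ha, hb, K, haK, hbK, hK⟩ := h
  refine ⟨hb, ha, {x | x ∉ K ∧ x ∉ T}, ⟨hbK, hb⟩, fun h => h.1 haK, ?_⟩
  rintro x ⟨hx, hxT⟩ y hxy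
  by_cases hyT : y ∈ T
  · exact Or.inr hyT
  · refine Or.inl ⟨fun hy => ?_, hyT⟩
    rcases hK y hy x hxy.symm with h | h
    · exact hx h
    · exact hxT h

lemma Sep.ne {a b : V} (h : Sep G T a b) : a ≠ b := by
  rintro rfl
  obtain ⟨-, -, K, h1, h2, -⟩ := h
  exact h2 h1

lemma not_sep_self (a : V) : ¬ Sep G T a a := fun h => h.ne rfl

lemma Sep.not_adj {a b : V} (h : Sep G T a b) : ¬ G.Adj a b := by
  obtain ⟨-, hb, K, h1, h2, hK⟩ := h
  intro hab
  rcases hK a h1 b hab with h | h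
  · exact h2 h
  · exact hb h

/-- Contrapositive of transitivity of lying in one component; it replaces most arguments with paths.
-/
lemma Sep.or_of_notMem {a b c : V} (h : Sep G T a b) (hc : c ∉ T) :
    Sep G T a c ∨ Sep G T c b := by
  obtain ⟨ha, hb, K, h1, h2, hK⟩ := h
  by_cases hcK : c ∈ K
  · exact Or.inr ⟨hc, hb, K, hcK, h2, hK⟩
  · exact Or.inl ⟨ha, hc, K, h1, hcK, hK⟩

lemma Sep.mono {T' : Set V} {a b : V} (h : Sep G T a b) (hT : T ⊆ T') (ha : a ∉ T')
    (hb : b ∉ T') : Sep G T' a b := by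
  obtain ⟨-, -, K, h1, h2, hK⟩ := h
  exact ⟨ha, hb, K, h1, h2, fun x hx y hxy => (hK x hx y hxy).imp_right fun h => hT h⟩

lemma sep_iff_not_reachable {a b : V} (ha : a ∈ Tᶜ) (hb : b ∈ Tᶜ) :
    Sep G T a b ↔ ¬ (deleteSet G T).Reachable ⟨a, ha⟩ ⟨b, hb⟩ := by
  constructor
  · rintro ⟨-, -, K, h1, h2, hK⟩ ⟨w⟩
    suffices H : ∀ (x y : ↥Tᶜ), (deleteSet G T).Walk x y → x.1 ∈ K → y.1 ∈ K from h2 (H _ _ w h1)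
    intro x y w
    induction w with
    | nil => exact id
    | @cons u v _ huv _ ih =>
      intro hu
      exact ih ((hK u.1 hu v.1 huv).resolve_right v.2)
  · intro h
    refine ⟨ha, hb, {x | ∃ hx : x ∈ Tᶜ, (deleteSet G T).Reachable ⟨a, ha⟩ ⟨x, hx⟩},
      ⟨ha, SimpleGraph.Reachable.refl _⟩, fun ⟨_, h'⟩ => h h', ?_⟩
    rintro x ⟨hx, hax⟩ y hxy
    by_cases hy : y ∈ T
    · exact Or.inr hy
    · exact Or.inl ⟨hy, hax.trans
        (SimpleGraph.Adj.reachable (show (deleteSet G T).Adj ⟨x, hx⟩ ⟨y, hy⟩ from hxy))⟩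

lemma connectedComponentMk_eq_iff (x y : ↥Tᶜ) :
    (deleteSet G T).connectedComponentMk x = (deleteSet G T).connectedComponentMk y ↔
      ¬ Sep G T x.1 y.1 := by
  rw [SimpleGraph.ConnectedComponent.eq, sep_iff_not_reachable x.2 y.2, not_not]

lemma card_le_numComponents [Finite V] {ι : Type*} (f : ι → V) (hf : ∀ i, f i ∉ T)
    (h : ∀ i j, i ≠ j → Sep G T (f i) (f j)) : Nat.card ι ≤ numComponents G T := by
  refine Nat.card_le_card_of_injective
    (fun i => (deleteSet G T).connectedComponentMk ⟨f i, hf i⟩) fun i j hij => ?_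
  by_contra hne
  exact (connectedComponentMk_eq_iff _ _).1 hij (h i j hne)

lemma numComponents_le_card {ι : Type*} [Finite ι] (f : ι → V) (hf : ∀ i, f i ∉ T)
    (h : ∀ x, x ∉ T → ∃ i, ¬ Sep G T (f i) x) : numComponents G T ≤ Nat.card ι := by
  refine Nat.card_le_card_of_surjective
    (fun i => (deleteSet G T).connectedComponentMk ⟨f i, hf i⟩) fun c => ?_
  induction c using SimpleGraph.ConnectedComponent.ind with
  | _ x =>
    obtain ⟨i, hi⟩ := h x.1 x.2
    exact ⟨i, (connectedComponentMk_eq_iff _ _).2 hi⟩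

lemma two_le_numComponents [Finite V] {a b : V} (h : Sep G T a b) : 2 ≤ numComponents G T := by
  have := card_le_numComponents (G := G) (T := T) (fun i : Bool => if i then a else b)
    (by rintro (_ | _) <;> simp [h.1, h.2.1])
    (by rintro (_ | _) (_ | _) hij <;> simp_all [h.symm])
  simpa using this

lemma three_le_numComponents [Finite V] {a b c : V} (hab : Sep G T a b) (hac : Sep G T a c)
    (hbc : Sep G T b c) : 3 ≤ numComponents G T := by
  have := card_le_numComponents (G := G) (T := T) (![a, b, c])
    (by intro i; fin_cases i <;> simp [hab.1, hab.2.1, hac.2.1])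
    (by intro i j hij
        fin_cases i <;> fin_cases j <;> simp_all [hab.symm, hac.symm, hbc.symm])
  simpa using this

lemma numComponents_le_ncard [Finite V] (L : Set V) (hL : ∀ l ∈ L, l ∉ T)
    (h : ∀ x, x ∉ T → ∃ l ∈ L, ¬ Sep G T l x) : numComponents G T ≤ L.ncard := by
  have := numComponents_le_card (G := G) (T := T) (fun i : L => i.1) (fun i => hL i.1 i.2)
    (fun x hx => by obtain ⟨l, hl, hs⟩ := h x hx; exact ⟨⟨l, hl⟩, hs⟩)
  rwa [Nat.card_coe_set_eq] at this

/-- Enlarging a separator by a union of components. -/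
lemma Sep.of_union {F : Set V} {a b : V} (h : Sep G (F ∪ T) a b)
    (hF : ∀ x ∈ F, ∀ y, G.Adj x y → y ∈ F ∨ y ∈ T) : Sep G T a b := by
  obtain ⟨ha, hb, K, h1, h2, hK⟩ := h
  simp only [Set.mem_union, not_or] at ha hb
  refine ⟨ha.2, hb.2, K \ (F ∪ T), ⟨h1, by simp [ha]⟩, fun h => h2 h.1, ?_⟩
  rintro x ⟨hxK, hx⟩ y hxy
  simp only [Set.mem_union, not_or] at hx
  rcases hK x hxK y hxy with h | h | h
  · by_cases hyT : y ∈ T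
    · exact Or.inr hyT
    · refine Or.inl ⟨h, ?_⟩
      simp only [Set.mem_union, not_or]
      refine ⟨fun hyF => ?_, hyT⟩
      exact (hF y hyF x hxy.symm).elim hx.1 hx.2
  · exact ((hF y h x hxy.symm).elim hx.1 hx.2).elim
  · exact Or.inr h

/-- If `t ∈ T` has no two separated neighbours, putting `t` back separates no less. -/
lemma Sep.sdiff_singleton {t x y : V} (h : Sep G T x y)
    (ht : ∀ b₁ b₂, G.Adj t b₁ → G.Adj t b₂ → ¬ Sep G T b₁ b₂) (htT : t ∈ T) :
    Sep G (T \ {t}) x y := by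
  obtain ⟨hx, hy, K, h1, h2, hK⟩ := h
  by_cases hk : ∃ k ∈ K, k ∉ T ∧ G.Adj t k
  · obtain ⟨k, hkK, hkT, htk⟩ := hk
    refine ⟨fun h => hx h.1, fun h => hy h.1, insert t K, Or.inr h1, ?_, ?_⟩
    · rintro (rfl | h)
      · exact hy htT
      · exact h2 h
    · rintro u (rfl | hu) v huv
      · by_cases hvT : v ∈ T
        · exact Or.inr ⟨hvT, huv.ne'⟩
        · by_contra hc
          push Not at hc
          exact ht k v htk huv ⟨hkT, hvT, K, hkK, fun h => hc.1 (Or.inr h), hK⟩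
      · by_cases hvt : v = t
        · exact Or.inl (Or.inl hvt)
        · exact (hK u hu v huv).imp Or.inr fun h => ⟨h, hvt⟩
  · push Not at hk
    refine ⟨fun h => hx h.1, fun h => hy h.1, K \ T, ⟨h1, hx⟩, fun h => h2 h.1, ?_⟩
    rintro u ⟨huK, huT⟩ v huv
    by_cases hvt : v = t
    · subst hvt
      exact (hk u huK huT huv.symm).elim
    by_cases hvT : v ∈ T
    · exact Or.inr ⟨hvT, hvt⟩
    · exact Or.inl ⟨(hK u huK v huv).resolve_right hvT, hvT⟩

/-- Putting `t` back merges exactly the components in which `t` has neighbours, so the count drops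
precisely when there are at least two of these. This turns the numerical definition of a cutset into
a local condition. -/
lemma numComponents_sdiff_lt_iff [Finite V] {t : V} (ht : t ∈ T) :
    numComponents G (T \ {t}) < numComponents G T ↔
      ∃ b₁ b₂, G.Adj t b₁ ∧ G.Adj t b₂ ∧ Sep G T b₁ b₂ := by
  have hmem : ∀ x : ↥Tᶜ, x.1 ∉ T \ {t} := fun x h => x.2 h.1
  constructor
  · intro h
    by_contra hc
    push Not at hc
    refine absurd h (not_lt.2 ?_)
    have := card_le_numComponents (G := G) (T := T \ {t})
      (fun c : (deleteSet G T).ConnectedComponent => c.out.1) (fun c => hmem _) ?_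
    · exact this
    · intro c d hcd
      refine Sep.sdiff_singleton ?_ (fun b₁ b₂ h1 h2 => hc b₁ b₂ h1 h2) ht
      by_contra hs
      rw [← connectedComponentMk_eq_iff] at hs
      exact hcd ((Quot.out_eq c).symm.trans (hs.trans (Quot.out_eq d)))
  · rintro ⟨b₁, b₂, h1, h2, hs⟩
    -- The component of `b₂` needs no representative of its own: once `t` is back, it is joined
    -- through `t` to the component of `b₁`.
    have hlt : numComponents G (T \ {t}) ≤
        Nat.card {c : (deleteSet G T).ConnectedComponent //
          c ≠ (deleteSet G T).connectedComponentMk ⟨b₂, hs.2.1⟩} := by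
      refine numComponents_le_card (fun c => c.1.out.1) (fun c => hmem _) ?_
      have key : ∀ x (hx : x ∉ T), ¬ Sep G T b₂ x ∨
          ∃ c : {c : (deleteSet G T).ConnectedComponent //
            c ≠ (deleteSet G T).connectedComponentMk ⟨b₂, hs.2.1⟩},
            ¬ Sep G T c.1.out.1 x := by
        intro x hx
        by_cases hx2 : Sep G T b₂ x
        · refine Or.inr ⟨⟨(deleteSet G T).connectedComponentMk ⟨x, hx⟩, ?_⟩, ?_⟩
          · intro h
            exact (connectedComponentMk_eq_iff _ _).1 h hx2.symm
          · rw [← connectedComponentMk_eq_iff (y := ⟨x, hx⟩)]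
            exact Quot.out_eq _
        · exact Or.inl hx2
      have notsep : ∀ {a b}, a ∉ T → b ∉ T → ¬ Sep G T a b → ¬ Sep G (T \ {t}) a b := by
        intro a b ha hb h h'
        exact h (h'.mono Set.sdiff_subset ha hb)
      have ht' : t ∉ T \ {t} := fun h => h.2 rfl
      obtain ⟨c1, hc1⟩ := (key b₁ hs.1).resolve_left (fun h => h hs.symm)
      have hc1t : ¬ Sep G (T \ {t}) c1.1.out.1 t := by
        intro h
        rcases h.or_of_notMem (c := b₁) (fun h => hs.1 h.1) with h | h
        · exact notsep c1.1.out.2 hs.1 hc1 h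
        · exact h.not_adj h1.symm
      intro x hx
      by_cases hxt : x = t
      · exact ⟨c1, hxt ▸ hc1t⟩
      have hxT : x ∉ T := fun h => hx ⟨h, hxt⟩
      rcases key x hxT with h | ⟨c, hc⟩
      · refine ⟨c1, fun h' => ?_⟩
        rcases h'.or_of_notMem ht' with h'' | h''
        · exact hc1t h''
        rcases h''.or_of_notMem (c := b₂) (fun h => hs.2.1 h.1) with h3 | h3
        · exact h3.not_adj h2
        · exact notsep hs.2.1 hxT h h3
      · exact ⟨c, notsep c.1.out.2 hxT hc⟩
    refine hlt.trans_lt ?_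
    have := Finite.card_subtype_lt (p := fun c : (deleteSet G T).ConnectedComponent =>
      c ≠ (deleteSet G T).connectedComponentMk ⟨b₂, hs.2.1⟩) (not_not.2 rfl)
    exact this

lemma isCutset_iff [Finite V] :
    IsCutset G T ↔ ∀ t ∈ T, ∃ b₁ b₂, G.Adj t b₁ ∧ G.Adj t b₂ ∧ Sep G T b₁ b₂ :=
  forall₂_congr fun _ ht => numComponents_sdiff_lt_iff ht

lemma numComponents_empty : numComponents G ∅ = Nat.card G.ConnectedComponent := by
  refine Nat.card_congr (SimpleGraph.Iso.connectedComponentEquiv ?_)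
  exact ⟨(Equiv.setCongr Set.compl_empty).trans (Equiv.Set.univ V), Iff.rfl⟩

lemma isCutVertex_iff [Finite V] {v : V} :
    IsCutVertex G v ↔ ∃ b₁ b₂, G.Adj v b₁ ∧ G.Adj v b₂ ∧ Sep G {v} b₁ b₂ := by
  rw [← numComponents_sdiff_lt_iff (Set.mem_singleton v), Set.sdiff_self, numComponents_empty]
  rfl

lemma numComponents_empty_of_connected (h : G.Connected) : numComponents G ∅ = 1 := by
  rw [numComponents_empty, Nat.card_eq_one_iff_unique]
  have := h.nonempty
  exact ⟨h.preconnected.subsingleton_connectedComponent, inferInstance⟩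

end Separation

/-! ### Accessible blocks, obstructions and the one-vertex cutset analysis -/

section Core

variable {V : Type*} {B : SimpleGraph V} {W : Set V}

/-- `T` is a cutset of the graph obtained from `B` by attaching whiskers at `W`. -/
def IsWhiskerCutset (B : SimpleGraph V) (W T : Set V) : Prop :=
  ∀ t ∈ T, (t ∈ W → ∃ b, b ∉ T ∧ B.Adj t b) ∧
    (t ∉ W → ∃ b₁ b₂, B.Adj t b₁ ∧ B.Adj t b₂ ∧ Sep B T b₁ b₂)

/-- `T` contains all neighbours of `v` in `B`, and it is a cutset of the graph obtained from `B` by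
attaching whiskers at `W` and deleting `v`. -/
structure IsObstruction (B : SimpleGraph V) (W : Set V) (v : V) (T : Set V) : Prop where
  notMem : v ∉ T
  adj_mem : ∀ x, B.Adj v x → x ∈ T
  whisker : ∀ t ∈ T, t ∈ W → ∃ b, b ∉ T ∧ b ≠ v ∧ B.Adj t b
  joins : ∀ t ∈ T, t ∉ W → ∃ b₁ b₂, b₁ ≠ v ∧ b₂ ≠ v ∧ B.Adj t b₁ ∧ B.Adj t b₂ ∧ Sep B T b₁ b₂

lemma IsObstruction.isWhiskerCutset {v : V} {T : Set V} (h : IsObstruction B W v T) :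
    IsWhiskerCutset B W T := fun t ht =>
  ⟨fun hw => (h.whisker t ht hw).imp fun _ hb => ⟨hb.1, hb.2.2⟩,
    fun hw => by
      obtain ⟨b₁, b₂, -, -, h1, h2, h3⟩ := h.joins t ht hw
      exact ⟨b₁, b₂, h1, h2, h3⟩⟩

/-- The properties of a connected graph `B` without cut vertices which say that attaching whiskers
at `W` gives an accessible graph. -/
structure IsAccessibleBlock (B : SimpleGraph V) (W : Set V) : Prop where
  conn : ∀ a b, ¬ Sep B ∅ a b
  noCut : ∀ v a b, ¬ Sep B {v} a b
  unmixed : ∀ T, IsWhiskerCutset B W T → numComponents B T = (T \ W).ncard + 1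
  acc : ∀ T, IsWhiskerCutset B W T → T.Nonempty → ∃ t ∈ T, IsWhiskerCutset B W (T \ {t})

/-- All neighbours of `u` are `w` and one more vertex outside `W`. -/
def IsPendantAt (B : SimpleGraph V) (W : Set V) (u w : V) : Prop :=
  ∃ y, y ∉ W ∧ ∀ x, B.Adj u x → x = w ∨ x = y

/-- `F` is a nonempty union of components of `B ∖ {u, w, y}` avoiding `W`, such that the rest of
`B ∖ {u, w, y}` is connected and contains a neighbour of `w`. -/
structure IsPocket (B : SimpleGraph V) (W : Set V) (u w y : V) (F : Set V) : Prop where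
  nonempty : F.Nonempty
  notMem : ∀ x ∈ F, x ∉ W
  notMem_left : y ∉ W
  notMem_right : y ∉ F
  closed : ∀ f ∈ F, ∀ x, B.Adj f x → x ∈ F ∨ x ∈ ({u, w, y} : Set V)
  rest : ∀ a b, ¬ Sep B (F ∪ {u, w, y}) a b
  adj_rest : ∃ r, r ∉ F ∪ {u, w, y} ∧ B.Adj w r

namespace IsAccessibleBlock

variable [Finite V] (h : IsAccessibleBlock B W)
include h

/-- Accessibility strips `T` down to a singleton cutset, and its vertex must lie in `W` because `B`
has no cut vertex. -/
lemma inter_nonempty {T : Set V} (hT : IsWhiskerCutset B W T) (hne : T.Nonempty) :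
    (T ∩ W).Nonempty := by
  induction hn : T.ncard using Nat.strong_induction_on generalizing T with
  | _ n ih =>
    obtain ⟨t, ht, hcut⟩ := h.acc T hT hne
    by_cases hne' : (T \ {t}).Nonempty
    · have := ih _ (hn ▸ Set.ncard_sdiff_singleton_lt_of_mem ht) hcut hne' rfl
      exact this.mono (Set.inter_subset_inter_left _ Set.sdiff_subset)
    · have hTt : T = {t} := by
        refine Set.eq_singleton_iff_unique_mem.2 ⟨ht, fun x hx => ?_⟩
        by_contra hxt
        exact hne' ⟨x, hx, hxt⟩
      subst hTt
      by_cases htW : t ∈ W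
      · exact ⟨t, rfl, htW⟩
      · obtain ⟨b₁, b₂, -, -, hs⟩ := (hT t rfl).2 htW
        exact (h.noCut _ _ _ hs).elim

/-- Vertices are removed by accessibility until the next removal would take the last vertex outside
`W`; the cutset at that moment is the one wanted. -/
lemma exists_insert {D : Set V} (hD : IsWhiskerCutset B W D) (hne : (D \ W).Nonempty) :
    ∃ y ∈ D \ W, ∃ W' ⊆ D ∩ W, W'.Nonempty ∧ IsWhiskerCutset B W (insert y W') := by
  induction hn : D.ncard using Nat.strong_induction_on generalizing D with
  | _ n ih =>
    obtain ⟨t, ht, hcut⟩ := h.acc D hD (hne.mono Set.sdiff_subset)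
    by_cases hne' : ((D \ {t}) \ W).Nonempty
    · obtain ⟨y, hy, W', hW', h1, h2⟩ :=
        ih _ (hn ▸ Set.ncard_sdiff_singleton_lt_of_mem ht) hcut hne' rfl
      exact ⟨y, ⟨hy.1.1, hy.2⟩, W', fun x hx => ⟨(hW' hx).1.1, (hW' hx).2⟩, h1, h2⟩
    · have key : ∀ x ∈ D, x ∉ W → x = t := by
        intro x hx hxW
        by_contra hxt
        exact hne' ⟨x, ⟨hx, hxt⟩, hxW⟩
      obtain ⟨y, hyD, hyW⟩ := hne
      have hyt := key y hyD hyW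
      subst hyt
      refine ⟨y, ⟨hyD, hyW⟩, D ∩ W, subset_rfl, h.inter_nonempty hD ⟨y, hyD⟩, ?_⟩
      have : insert y (D ∩ W) = D := by
        ext x
        by_cases hx : x ∈ W
        · simp only [Set.mem_insert_iff, Set.mem_inter_iff, hx, and_true]
          exact ⟨fun h => h.elim (fun h => h ▸ hyD) id, Or.inr⟩
        · simp only [Set.mem_insert_iff, Set.mem_inter_iff, hx, and_false, or_false]
          exact ⟨fun h => h ▸ hyD, fun h => key x h hx⟩
      rwa [this]

/-- The neighbours of `a` that also have a neighbour outside the closed neighbourhood of `a` form a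
cutset, each joining `a` to the far side. By connectedness it is nonempty, so it meets `W`. -/
lemma exists_adj_of_not_adj {a b : V} (hab : a ≠ b) (hnadj : ¬ B.Adj a b) :
    ∃ w ∈ W, B.Adj a w := by
  have hcut : IsWhiskerCutset B W {z | B.Adj a z ∧ ∃ k, k ≠ a ∧ ¬ B.Adj a k ∧ B.Adj z k} := by
    rintro z ⟨haz, k, hka, hak, hzk⟩
    refine ⟨fun _ => ⟨a, fun h => h.1.ne rfl, haz.symm⟩, fun _ => ⟨k, a, hzk, haz.symm, ?_⟩⟩
    refine ⟨fun h => hak h.1, fun h => h.1.ne rfl, {k | k ≠ a ∧ ¬ B.Adj a k}, ⟨hka, hak⟩,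
      fun h => h.1 rfl, ?_⟩
    rintro x ⟨hx, hax⟩ y hxy
    by_cases hay : B.Adj a y
    · exact Or.inr ⟨hay, x, hx, hax, hxy.symm⟩
    · exact Or.inl ⟨fun h => hax (h ▸ hxy.symm), hay⟩
  obtain ⟨w, hw, hwW⟩ := h.inter_nonempty hcut (by
    by_contra hne
    refine h.conn b a ⟨id, id, {k | k ≠ a ∧ ¬ B.Adj a k}, ⟨hab.symm, hnadj⟩, fun h => h.1 rfl, ?_⟩
    rintro x ⟨hx, hax⟩ y hxy
    refine Or.inl ⟨fun h => hax (h ▸ hxy.symm), fun hay => hne ⟨y, hay, x, hx, hax, hxy.symm⟩⟩)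
  exact ⟨w, hwW, hw.1⟩

lemma exists_adj_mem (hW : W.Nontrivial) (a : V) : ∃ w ∈ W, B.Adj a w := by
  obtain ⟨w, hw, hwa⟩ := hW.exists_ne a
  by_cases haw : B.Adj a w
  · exact ⟨w, hw, haw⟩
  · exact h.exists_adj_of_not_adj hwa.symm haw

/-- A vertex with a pocket of the graph hanging on it and one further vertex has no obstruction. -/
lemma not_isObstruction (hW : W.Nontrivial) {u y : V} {F T : Set V} (hF : F.Nonempty)
    (hFW : ∀ x ∈ F, x ∉ W) (hy : y ∉ W)
    (hcl : ∀ f ∈ F, ∀ x, B.Adj f x → x ∈ F ∨ x = u ∨ x = y) : ¬ IsObstruction B W u T := by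
  intro hT
  -- The neighbour of `f` in `W` can only be `u`. Hence `F` lies inside `T`, and the two separated
  -- neighbours demanded of `f` would both have to be `y`.
  have hadj : ∀ f ∈ F, B.Adj u f := by
    intro f hf
    obtain ⟨w, hw, hfw⟩ := h.exists_adj_mem hW f
    rcases hcl f hf w hfw with h1 | rfl | rfl
    · exact (hFW _ h1 hw).elim
    · exact hfw.symm
    · exact (hy hw).elim
  obtain ⟨f, hf⟩ := hF
  obtain ⟨b₁, b₂, h1, h2, a1, a2, hs⟩ := hT.joins f (hT.adj_mem f (hadj f hf)) (hFW f hf)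
  have e1 : b₁ = y := ((hcl f hf b₁ a1).resolve_left
    fun hb => hs.1 (hT.adj_mem _ (hadj _ hb))).resolve_left h1
  have e2 : b₂ = y := ((hcl f hf b₂ a2).resolve_left
    fun hb => hs.2.1 (hT.adj_mem _ (hadj _ hb))).resolve_left h2
  exact hs.ne (e1.trans e2.symm)

/-- The analysis of a cutset with exactly one vertex outside `W`. -/
lemma pendant_or_pocket (hW : W.Nontrivial) {u w y r : V} {W' Tu Tw : Set V}
    (hy : y ∉ W) (hW' : W' ⊆ {u, w}) (hne : W'.Nonempty)
    (hcut : IsWhiskerCutset B W (insert y W')) (hTu : IsObstruction B W u Tu)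
    (hTw : IsObstruction B W w Tw) (hwr : B.Adj w r) (hr : r ∉ insert y W') (hru : r ≠ u)
    (hother : ∀ x ∈ W, x ≠ u → x ≠ w → ¬ Sep B (insert y W') x r) :
    IsPendantAt B W u w ∨
      ∃ F, IsPocket B W u w y F ∧ ∀ x ∈ F, Sep B (insert y W') x r := by
  set Z := insert y W' with hZ
  have hyZ : y ∈ Z := Set.mem_insert _ _
  have hZsub : ∀ x ∈ Z, x = y ∨ x = u ∨ x = w := fun x hx => hx.imp id fun hx => hW' hx
  -- the part separated from `r`
  have hclosed : ∀ x, Sep B Z x r → ∀ v, B.Adj x v → Sep B Z v r ∨ v ∈ Z := by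
    intro x hx v hxv
    by_cases hv : v ∈ Z
    · exact Or.inr hv
    · exact Or.inl ((hx.or_of_notMem hv).resolve_left fun h => h.not_adj hxv)
  have hex : ∃ x, Sep B Z x r := by
    obtain ⟨b₁, b₂, -, -, hs⟩ := (hcut y hyZ).2 hy
    rcases hs.or_of_notMem hr with h | h
    · exact ⟨_, h⟩
    · exact ⟨_, h.symm⟩
  have hw : ¬ Sep B Z w r := fun h => h.not_adj hwr
  have hyS : ¬ Sep B Z y r := fun h => h.1 hyZ
  have hWS : ∀ x ∈ W, Sep B Z x r → x = u := by
    intro x hx hxs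
    by_contra hxu
    by_cases hxw : x = w
    · exact hw (hxw ▸ hxs)
    · exact hother x hx hxu hxw hxs
  -- connectivity of the rest
  have hrest : ∀ F : Set V, F ∪ {u, w, y} = {x | Sep B Z x r} ∪ Z →
      ∀ a b, ¬ Sep B (F ∪ {u, w, y}) a b := by
    intro F hF a b hab
    rw [hF] at hab
    have ha : ¬ Sep B Z a r := fun h => hab.1 (Or.inl h)
    have hb : ¬ Sep B Z b r := fun h => hab.2.1 (Or.inl h)
    rcases (hab.of_union hclosed).or_of_notMem hr with h | h
    · exact ha h
    · exact hb h.symm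
  -- The part cut off from `r` meets `W` at most in `u`. If it contains `u`, the pocket is that part
  -- without `u`, and `u` is pendant when nothing remains. If not, the whole part is the pocket,
  -- unless `u` or `w` is missing from `Z`; then the part hangs on `y` and at most one of the two,
  -- which `not_isObstruction` forbids.
  by_cases hu : Sep B Z u r
  · have hwZ : w ∈ Z := by
      obtain ⟨x, hx⟩ := hne
      rcases hW' hx with rfl | rfl
      · exact (hu.1 (Or.inr hx)).elim
      · exact Or.inr hx
    by_cases hF : ({x | Sep B Z x r} \ {u}).Nonempty
    · right
      refine ⟨_, ⟨hF, fun x hx hxW => hx.2 (hWS x hxW hx.1), hy, fun h => hyS h.1, ?_, ?_, ?_⟩,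
        fun x hx => hx.1⟩
      · intro f hf x hfx
        rcases hclosed f hf.1 x hfx with h1 | h1
        · by_cases hxu : x = u
          · exact Or.inr (Or.inl hxu)
          · exact Or.inl ⟨h1, hxu⟩
        · rcases hZsub x h1 with rfl | rfl | rfl <;> simp
      · apply hrest
        ext x
        have := hZsub x
        by_cases hxu : x = u
        · subst hxu; simp [hu]
        by_cases hxw : x = w
        · subst hxw; simp [hwZ]
        by_cases hxy : x = y
        · subst hxy; simp [hyZ]
        have : x ∉ Z := fun h => by rcases hZsub x h with h | h | h <;> contradiction
        simp [hxu, hxw, hxy, this]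
      · refine ⟨r, ?_, hwr⟩
        rintro (h1 | h1 | h1 | h1)
        · exact not_sep_self _ h1.1
        · exact hru h1
        · exact hwr.ne' h1
        · exact hr (h1 ▸ hyZ)
    · left
      refine ⟨y, hy, fun x hx => ?_⟩
      rcases hclosed u hu x hx with h1 | h1
      · exact (hF ⟨x, h1, hx.ne'⟩).elim
      · rcases hZsub x h1 with rfl | rfl | rfl
        · exact Or.inr rfl
        · exact (hx.ne rfl).elim
        · exact Or.inl rfl
  · have hFW : ∀ x ∈ {x | Sep B Z x r}, x ∉ W := fun x hx hxW => hu (hWS x hxW hx ▸ hx)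
    by_cases huZ : u ∈ Z
    · by_cases hwZ : w ∈ Z
      · right
        refine ⟨_, ⟨hex, hFW, hy, hyS, ?_, ?_, ?_⟩, fun x hx => hx⟩
        · intro f hf x hfx
          refine (hclosed f hf x hfx).imp id fun h1 => ?_
          rcases hZsub x h1 with rfl | rfl | rfl <;> simp
        · apply hrest
          congr 1
          ext x
          simp only [Set.mem_insert_iff, Set.mem_singleton_iff]
          constructor
          · rintro (rfl | rfl | rfl) <;> assumption
          · intro h
            have := hZsub x h
            tauto
        · refine ⟨r, ?_, hwr⟩
          rintro (h1 | h1 | h1 | h1)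
          · exact not_sep_self _ h1
          · exact hru h1
          · exact hwr.ne' h1
          · exact hr (h1 ▸ hyZ)
      · refine (h.not_isObstruction hW (y := y) hex hFW hy ?_ hTu).elim
        intro f hf x hfx
        refine (hclosed f hf x hfx).imp id fun h1 => ?_
        rcases hZsub x h1 with rfl | rfl | rfl
        · exact Or.inr rfl
        · exact Or.inl rfl
        · exact (hwZ h1).elim
    · refine (h.not_isObstruction hW (y := y) hex hFW hy ?_ hTw).elim
      intro f hf x hfx
      refine (hclosed f hf x hfx).imp id fun h1 => ?_
      rcases hZsub x h1 with rfl | rfl | rfl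
      · exact Or.inr rfl
      · exact (huZ h1).elim
      · exact Or.inl rfl

end IsAccessibleBlock

end Core

/-! ### Pockets: component counting and descent -/

section Pocket

variable {V : Type*} {B : SimpleGraph V} {W : Set V}

/-- Separation of neighbours inside a pocket. -/
lemma IsObstruction.exists_sep_of_mem {p q y : V} {F T : Set V} (hT : IsObstruction B W p T)
    (hFW : ∀ x ∈ F, x ∉ W)
    (hcl : ∀ f ∈ F, ∀ x, B.Adj f x → x ∈ F ∨ x = p ∨ x = q ∨ x = y)
    (hpF : p ∉ F) (hqT : q ∈ T) {t : V} (htF : t ∈ F) (htT : t ∈ T) :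
    ∃ b₁ b₂, b₁ ∈ F \ T ∧ B.Adj t b₁ ∧ B.Adj t b₂ ∧ ∀ Z : Set V, F ∩ T ⊆ Z → q ∈ Z →
      (∀ x ∈ Z, x ∈ F ∩ T ∨ x = p ∨ x = q ∨ x = y) → (y ∈ Z → y ∈ T) →
      (y ∈ T → y ∉ Z → ∀ d ∈ F \ T, ¬ B.Adj d y) → Sep B Z b₁ b₂ := by
  -- The side `K` of `b₁` is chosen to avoid `y` when `y ∉ T`: as `y` is separated from one of the
  -- two neighbours, that one is named `b₁`. If the set separating it from `y` contains the other
  -- neighbour, it is intersected with a set separating the two.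
  obtain ⟨b₁, b₂, h1, h2, a1, a2, hs, K, hbK, hyK⟩ :
      ∃ b₁ b₂, b₁ ≠ p ∧ b₂ ≠ p ∧ B.Adj t b₁ ∧ B.Adj t b₂ ∧ Sep B T b₁ b₂ ∧
      ∃ K : Set V, (b₁ ∈ K ∧ b₂ ∉ K ∧ ∀ x ∈ K, ∀ y, B.Adj x y → y ∈ K ∨ y ∈ T) ∧
        (y ∈ K → y ∈ T) := by
    obtain ⟨b₁, b₂, h1, h2, a1, a2, hs⟩ := hT.joins t htT (hFW t htF)
    by_cases hy : y ∈ T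
    · obtain ⟨K, hK⟩ := hs.2.2
      exact ⟨b₁, b₂, h1, h2, a1, a2, hs, K, hK, fun _ => hy⟩
    · rcases hs.or_of_notMem hy with h | h
      · obtain ⟨-, -, K, k1, k2, k3⟩ := h
        by_cases hb : b₂ ∈ K
        · obtain ⟨L, l1, l2, l3⟩ := hs.2.2
          refine ⟨b₁, b₂, h1, h2, a1, a2, hs, K ∩ L, ⟨⟨k1, l1⟩, fun h => l2 h.2, ?_⟩,
            fun h => (k2 h.1).elim⟩
          intro x hx v hxv
          rcases k3 x hx.1 v hxv with h | h
          · exact (l3 x hx.2 v hxv).imp (fun h' => ⟨h, h'⟩) id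
          · exact Or.inr h
        · exact ⟨b₁, b₂, h1, h2, a1, a2, hs, K, ⟨k1, hb, k3⟩, fun h => (k2 h).elim⟩
      · obtain ⟨-, -, K, k1, k2, k3⟩ := h.symm
        by_cases hb : b₁ ∈ K
        · obtain ⟨L, l1, l2, l3⟩ := hs.symm.2.2
          refine ⟨b₂, b₁, h2, h1, a2, a1, hs.symm, K ∩ L, ⟨⟨k1, l1⟩, fun h => l2 h.2, ?_⟩,
            fun h => (k2 h.1).elim⟩
          intro x hx v hxv
          rcases k3 x hx.1 v hxv with h | h
          · exact (l3 x hx.2 v hxv).imp (fun h' => ⟨h, h'⟩) id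
          · exact Or.inr h
        · exact ⟨b₂, b₁, h2, h1, a2, a1, hs.symm, K, ⟨k1, hb, k3⟩, fun h => (k2 h).elim⟩
  have hmem : ∀ b, b ≠ p → B.Adj t b → b ∉ T → b ∈ F \ T ∨ b = y := by
    intro b hb a hbT
    rcases hcl t htF b a with h | rfl | rfl | rfl
    · exact Or.inl ⟨h, hbT⟩
    · exact (hb rfl).elim
    · exact (hbT hqT).elim
    · exact Or.inr rfl
  have hb1 : b₁ ∈ F \ T := (hmem b₁ h1 a1 hs.1).resolve_right
    fun h => hs.1 (h ▸ hyK (h ▸ hbK.1))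
  refine ⟨b₁, b₂, hb1, a1, a2, fun Z hZ1 hqZ hZ2 hyZ hyd => ?_⟩
  have hnot : ∀ b, b ≠ p → b ∈ F \ T ∨ b = y → b ∉ T → b ∉ Z := by
    intro b hbp hb hbT hbZ
    rcases hZ2 b hbZ with h | h | h | h
    · exact hbT h.2
    · exact hbp h
    · exact hbT (h ▸ hqT)
    · exact hbT (h ▸ hyZ (h ▸ hbZ))
  refine ⟨hnot b₁ h1 (Or.inl hb1) hs.1, hnot b₂ h2 (hmem b₂ h2 a2 hs.2.1) hs.2.1,
    (K ∩ F) \ T, ⟨⟨hbK.1, hb1.1⟩, hb1.2⟩, fun h => hbK.2.1 h.1.1, ?_⟩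
  rintro x ⟨⟨hxK, hxF⟩, hxT⟩ v hxv
  by_cases hvZ : v ∈ Z
  · exact Or.inr hvZ
  left
  rcases hcl x hxF v hxv with h | rfl | rfl | rfl
  · have hvT : v ∉ T := fun hv => hvZ (hZ1 ⟨h, hv⟩)
    exact ⟨⟨(hbK.2.2 x hxK v hxv).resolve_right hvT, h⟩, hvT⟩
  · exact (hxT (hT.adj_mem x hxv.symm)).elim
  · exact (hvZ hqZ).elim
  · by_cases hvT : v ∈ T
    · exact (hyd hvT hvZ x ⟨hxF, hxT⟩ hxv).elim
    · exact (hvT (hyK ((hbK.2.2 x hxK v hxv).resolve_right hvT))).elim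

namespace IsAccessibleBlock

variable [Finite V] (h : IsAccessibleBlock B W)
include h

/-- In a pocket without cutsets, an obstruction for `p` leaves many vertices outside. -/
lemma ncard_inter_le (hW : W.Nontrivial) {p q y r₀ : V} {F T T' : Set V}
    (hp : p ∈ W) (hq : q ∈ W) (hpq : B.Adj p q) (hF : F.Nonempty) (hFW : ∀ x ∈ F, x ∉ W)
    (hy : y ∉ W) (hyF : y ∉ F)
    (hcl : ∀ f ∈ F, ∀ x, B.Adj f x → x ∈ F ∨ x = p ∨ x = q ∨ x = y)
    (hrest : ∀ a b, ¬ Sep B (F ∪ {p, q, y}) a b) (hr₀ : r₀ ∉ F ∪ {p, q, y}) (hyr : B.Adj y r₀)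
    (hT : IsObstruction B W p T) (hT' : IsObstruction B W q T')
    (hZ : ∀ Z ⊆ F ∪ {p, q}, IsWhiskerCutset B W Z → ¬ (Z \ W).Nonempty) :
    (F ∩ T).ncard ≤ (F \ T).ncard ∧
      ((∃ r, r ∉ F ∪ {p, q, y} ∧ B.Adj p r) → (F ∩ T).ncard + 1 ≤ (F \ T).ncard) := by
  have hqT : q ∈ T := hT.adj_mem q hpq
  have hpF : p ∉ F := fun h => hFW p h hp
  have hqF : q ∉ F := fun h => hFW q h hq
  have hyp : y ≠ p := fun h => hy (h ▸ hp)
  have hyq : y ≠ q := fun h => hy (h ▸ hq)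
  obtain ⟨t₀, ht₀F, ht₀T⟩ : (F ∩ T).Nonempty := by
    by_contra hne
    refine h.not_isObstruction hW (y := y) hF hFW hy (fun f hf x hfx => ?_) hT'
    rcases hcl f hf x hfx with h1 | rfl | rfl | rfl
    · exact Or.inl h1
    · exact (hne ⟨f, hf, hT.adj_mem f hfx.symm⟩).elim
    · exact Or.inr (Or.inl rfl)
    · exact Or.inr (Or.inr rfl)
  have inner := fun t htF htT => hT.exists_sep_of_mem hFW hcl hpF hqT (t := t) htF htT
  obtain ⟨d₀, -, hd₀, -⟩ := inner t₀ ht₀F ht₀T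
  have hqd₀ : B.Adj q d₀ := by
    obtain ⟨w, hw, hdw⟩ := h.exists_adj_mem hW d₀
    rcases hcl d₀ hd₀.1 w hdw with h1 | rfl | rfl | rfl
    · exact (hFW w h1 hw).elim
    · exact (hd₀.2 (hT.adj_mem d₀ hdw.symm)).elim
    · exact hdw.symm
    · exact (hy hw).elim
  -- `y` lies in `T` and is adjacent to `F ∖ T`
  obtain ⟨hyT, d₁, hd₁, hyd₁⟩ : y ∈ T ∧ ∃ d ∈ F \ T, B.Adj d y := by
    by_contra hcon
    have hyd : y ∈ T → ∀ d ∈ F \ T, ¬ B.Adj d y := fun hyT d hd hdy => hcon ⟨hyT, d, hd, hdy⟩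
    -- Were the claim about `y` false, this would be a cutset inside `F ∪ {p, q}` with a vertex
    -- outside `W`, against `hZ`. The vertex `p` is included only if it keeps a neighbour outside
    -- `Z`.
    set Z : Set V := {x | x ∈ F ∩ T ∨ x = q ∨ (x = p ∧ ∃ n, B.Adj p n ∧ n ∉ F ∧ n ≠ q)} with hZdef
    have hyZ : y ∉ Z := by
      rintro (h1 | h1 | h1)
      · exact hyF h1.1
      · exact hyq h1
      · exact hyp h1.1
    refine hZ Z ?_ ?_ ⟨t₀, Or.inl ⟨ht₀F, ht₀T⟩, hFW _ ht₀F⟩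
    · rintro x (h1 | rfl | ⟨rfl, -⟩)
      · exact Or.inl h1.1
      · exact Or.inr (by simp)
      · exact Or.inr (by simp)
    · rintro t (ht | rfl | ⟨rfl, n, hn, hnF, hnq⟩)
      · refine ⟨fun hw => (hFW t ht.1 hw).elim, fun _ => ?_⟩
        obtain ⟨b₁, b₂, -, a1, a2, hs⟩ := inner t ht.1 ht.2
        refine ⟨b₁, b₂, a1, a2, hs Z (fun x hx => Or.inl hx) (Or.inr (Or.inl rfl)) ?_
          (fun hy' => (hyZ hy').elim) fun hyT _ => hyd hyT⟩
        rintro x (h1 | h1 | h1)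
        · exact Or.inl h1
        · exact Or.inr (Or.inr (Or.inl h1))
        · exact Or.inr (Or.inl h1.1)
      · refine ⟨fun _ => ⟨d₀, ?_, hqd₀⟩, fun hw => (hw hq).elim⟩
        rintro (h1 | h1 | h1)
        · exact hd₀.2 h1.2
        · exact hqF (h1 ▸ hd₀.1)
        · exact hpF (h1.1 ▸ hd₀.1)
      · refine ⟨fun _ => ⟨n, ?_, hn⟩, fun hw => (hw hp).elim⟩
        rintro (h1 | h1 | h1)
        · exact hnF h1.1
        · exact hnq h1
        · exact hn.ne' h1.1
  -- the cutset to be counted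
  set X : Set V := {x | x ∈ F ∩ T ∨ x = q ∨ x = y ∨
    (x = p ∧ ∃ r, r ∉ F ∪ {p, q, y} ∧ B.Adj p r)} with hX
  have hyX : y ∈ X := Or.inr (Or.inr (Or.inl rfl))
  have hXsub : ∀ x ∈ X, x ∈ F ∩ T ∨ x = p ∨ x = q ∨ x = y := by
    rintro x (h1 | h1 | h1 | h1)
    · exact Or.inl h1
    · exact Or.inr (Or.inr (Or.inl h1))
    · exact Or.inr (Or.inr (Or.inr h1))
    · exact Or.inr (Or.inl h1.1)
  have hXsub' : X ⊆ F ∪ {p, q, y} := by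
    intro x hx
    rcases hXsub x hx with h1 | rfl | rfl | rfl
    · exact Or.inl h1.1
    all_goals exact Or.inr (by simp)
  have hdX : ∀ d ∈ F \ T, d ∉ X := by
    intro d hd hdX
    rcases hXsub d hdX with h1 | rfl | rfl | rfl
    · exact hd.2 h1.2
    · exact hpF hd.1
    · exact hqF hd.1
    · exact hyF hd.1
  have hr₀X : r₀ ∉ X := fun h => hr₀ (hXsub' h)
  have hXcut : IsWhiskerCutset B W X := by
    rintro t (ht | rfl | rfl | ⟨rfl, r, hr, hpr⟩)
    · refine ⟨fun hw => (hFW t ht.1 hw).elim, fun _ => ?_⟩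
      obtain ⟨b₁, b₂, -, a1, a2, hs⟩ := inner t ht.1 ht.2
      exact ⟨b₁, b₂, a1, a2, hs X (fun x hx => Or.inl hx) (Or.inr (Or.inl rfl)) hXsub
        (fun _ => hyT) fun _ hn => (hn hyX).elim⟩
    · exact ⟨fun _ => ⟨d₀, hdX d₀ hd₀, hqd₀⟩, fun hw => (hw hq).elim⟩
    · refine ⟨fun hw => (hy hw).elim, fun _ => ⟨d₁, r₀, hyd₁.symm, hyr, hdX d₁ hd₁, hr₀X,
        F \ T, hd₁, fun h => hr₀ (Or.inl h.1), ?_⟩⟩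
      intro x hx v hxv
      rcases hcl x hx.1 v hxv with h1 | rfl | rfl | rfl
      · by_cases hvT : v ∈ T
        · exact Or.inr (Or.inl ⟨h1, hvT⟩)
        · exact Or.inl ⟨h1, hvT⟩
      · exact (hx.2 (hT.adj_mem x hxv.symm)).elim
      · exact Or.inr (Or.inr (Or.inl rfl))
      · exact Or.inr hyX
    · exact ⟨fun _ => ⟨r, fun h => hr (hXsub' h), hpr⟩, fun hw => (hw hp).elim⟩
  have hcount := h.unmixed X hXcut
  have hXW : X \ W = insert y (F ∩ T) := by
    ext x
    constructor
    · rintro ⟨hx, hxW⟩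
      rcases hXsub x hx with h1 | rfl | rfl | rfl
      · exact Or.inr h1
      · exact (hxW hp).elim
      · exact (hxW hq).elim
      · exact Or.inl rfl
    · rintro (rfl | hx)
      · exact ⟨hyX, hy⟩
      · exact ⟨Or.inl hx, hFW x hx.1⟩
  rw [hXW, Set.ncard_insert_of_notMem fun h1 => hyF h1.1] at hcount
  -- Upper bound for the count: the rest is connected and needs only `r₀`, while `F ∖ T` represents
  -- itself. Only `p` may need one more representative, when it is not in `X`; this costs the `1` by
  -- which the two inequalities differ. Unmixedness gives exactly `|F ∩ T| + 2` components.
  have hcover : ∀ x, x ∉ X → x = p ∨ ∃ l ∈ insert r₀ (F \ T), ¬ Sep B X l x := by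
    intro x hx
    by_cases hxF : x ∈ F
    · exact Or.inr ⟨x, Or.inr ⟨hxF, fun h1 => hx (Or.inl ⟨hxF, h1⟩)⟩, not_sep_self x⟩
    by_cases hxp : x = p
    · exact Or.inl hxp
    · refine Or.inr ⟨r₀, Or.inl rfl, fun hs => hrest _ _ (hs.mono hXsub' hr₀ ?_)⟩
      rintro (h1 | h1 | h1 | h1)
      · exact hxF h1
      · exact hxp h1
      · exact hx (Or.inr (Or.inl h1))
      · exact hx (h1 ▸ hyX)
  have hL : ∀ l ∈ insert r₀ (F \ T), l ∉ X := by
    rintro l (rfl | hl)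
    · exact hr₀X
    · exact hdX l hl
  have hcard : (insert r₀ (F \ T)).ncard ≤ (F \ T).ncard + 1 := Set.ncard_insert_le _ _
  by_cases hpr : ∃ r, r ∉ F ∪ {p, q, y} ∧ B.Adj p r
  · have hpX : p ∈ X := Or.inr (Or.inr (Or.inr ⟨rfl, hpr⟩))
    have := numComponents_le_ncard (G := B) (T := X) _ hL fun x hx =>
      (hcover x hx).resolve_left fun h1 => hx (h1 ▸ hpX)
    exact ⟨by omega, fun _ => by omega⟩
  · have hpX : p ∉ X := by
      rintro (h1 | h1 | h1 | h1)
      · exact hpF h1.1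
      · exact hpq.ne h1
      · exact hyp h1.symm
      · exact hpr h1.2
    have := numComponents_le_ncard (G := B) (T := X) (insert p (insert r₀ (F \ T))) (by
      rintro l (rfl | hl)
      · exact hpX
      · exact hL l hl) (by
      intro x hx
      rcases hcover x hx with rfl | ⟨l, hl, hs⟩
      · exact ⟨x, Or.inl rfl, not_sep_self x⟩
      · exact ⟨l, Or.inr hl, hs⟩)
    have h3 := Set.ncard_insert_le p (insert r₀ (F \ T))
    exact ⟨by omega, fun h1 => (hpr h1).elim⟩

/-- If both `u` and `w` have an obstruction, there is no pocket, unless `u` is pendant. -/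
lemma isPendantAt_of_isPocket (hW : W.Nontrivial) {u w : V} (hu : u ∈ W) (hw : w ∈ W)
    (huw : B.Adj u w) {Tu Tw : Set V} (hTu : IsObstruction B W u Tu)
    (hTw : IsObstruction B W w Tw) {y : V} {F : Set V} (hF : IsPocket B W u w y F) :
    IsPendantAt B W u w := by
  induction hn : F.ncard using Nat.strong_induction_on generalizing F y with
  | _ n ih =>
  by_contra hQ
  obtain ⟨r, hr, hwr⟩ := hF.adj_rest
  have hru : r ≠ u := fun h1 => hr (Or.inr (Or.inl h1))
  have hrw : r ≠ w := hwr.ne'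
  have hry : r ≠ y := fun h1 => hr (Or.inr (Or.inr (Or.inr h1)))
  have hrF : r ∉ F := fun h1 => hr (Or.inl h1)
  have huF : u ∉ F := fun h1 => hF.notMem u h1 hu
  have hwF : w ∉ F := fun h1 => hF.notMem w h1 hw
  have hyu : y ≠ u := fun h1 => hF.notMem_left (h1 ▸ hu)
  have hyw : y ≠ w := fun h1 => hF.notMem_left (h1 ▸ hw)
  have hcl : ∀ f ∈ F, ∀ x, B.Adj f x → x ∈ F ∨ x = u ∨ x = w ∨ x = y := hF.closed
  -- `y` has a neighbour in the rest
  obtain ⟨r₁, hr₁, hyr₁⟩ : ∃ r₁, r₁ ∉ F ∪ {u, w, y} ∧ B.Adj y r₁ := by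
    by_contra hcon
    push Not at hcon
    -- If `y` had no neighbour in the rest, `{u, w} ⊆ W` would be a cutset separating `y` from `r`,
    -- whereas unmixedness allows it only one component.
    have hcut : IsWhiskerCutset B W {u, w} := by
      rintro t (rfl | rfl)
      · refine ⟨fun _ => ?_, fun h1 => (h1 hu).elim⟩
        by_contra hc
        push Not at hc
        refine hQ ⟨y, hF.notMem_left, fun x hx => ?_⟩
        by_contra hxw
        refine hc x (fun h1 => ?_) hx
        rcases h1 with rfl | rfl
        · exact hx.ne rfl
        · exact hxw (Or.inl rfl)
      · refine ⟨fun _ => ⟨r, ?_, hwr⟩, fun h1 => (h1 hw).elim⟩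
        rintro (h1 | h1)
        · exact hru h1
        · exact hrw h1
    have hsep : Sep B {u, w} y r := by
      refine ⟨?_, ?_, insert y F, Or.inl rfl, ?_, ?_⟩
      · rintro (h1 | h1)
        · exact hyu h1
        · exact hyw h1
      · rintro (h1 | h1)
        · exact hru h1
        · exact hrw h1
      · rintro (h1 | h1)
        · exact hry h1
        · exact hrF h1
      · rintro x (rfl | hx) v hxv
        · by_contra hc
          refine hcon v ?_ hxv
          rintro (h1 | h1 | h1 | h1)
          · exact hc (Or.inl (Or.inr h1))
          · exact hc (Or.inr (Or.inl h1))
          · exact hc (Or.inr (Or.inr h1))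
          · exact hxv.ne' h1
        · rcases hcl x hx v hxv with h1 | h1 | h1 | h1
          · exact Or.inl (Or.inr h1)
          · exact Or.inr (Or.inl h1)
          · exact Or.inr (Or.inr h1)
          · exact Or.inl (Or.inl h1)
    have h1 := h.unmixed _ hcut
    have h2 := two_le_numComponents hsep
    have h3 : ({u, w} : Set V) \ W = ∅ := by
      ext x
      simp only [Set.mem_sdiff, Set.mem_insert_iff, Set.mem_singleton_iff, Set.mem_empty_iff_false,
        iff_false, not_and, not_not]
      rintro (rfl | rfl) <;> assumption
    rw [h3, Set.ncard_empty] at h1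
    omega
  -- Descent: such a cutset would produce a pocket `F'` inside `F`, and properly so because it
  -- misses `y' ∈ F`. Containment holds because the rest, and `y` through `r₁`, stays connected to
  -- `r`.
  have hZ : ∀ Z ⊆ F ∪ {u, w}, IsWhiskerCutset B W Z → ¬ (Z \ W).Nonempty := by
    intro Z hZ hZcut hne
    obtain ⟨y', hy', W', hW', hne', hcut⟩ := h.exists_insert hZcut hne
    have hy'F : y' ∈ F := by
      rcases hZ hy'.1 with h1 | rfl | rfl
      · exact h1
      · exact (hy'.2 hu).elim
      · exact (hy'.2 hw).elim
    have hW'sub : W' ⊆ {u, w} := by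
      intro x hx
      exact (hZ (hW' hx).1).resolve_left fun h1 => hF.notMem x h1 (hW' hx).2
    have hZsub : insert y' W' ⊆ F ∪ {u, w, y} := by
      rintro x (rfl | hx)
      · exact Or.inl hy'F
      · rcases hW'sub hx with rfl | rfl <;> exact Or.inr (by simp)
    have hnsep : ∀ x, x ∉ F ∪ {u, w, y} → ¬ Sep B (insert y' W') x r := fun x hx hs =>
      hF.rest _ _ (hs.mono hZsub hx hr)
    rcases h.pendant_or_pocket hW hy'.2 hW'sub hne' hcut hTu hTw hwr (fun h1 => hr (hZsub h1)) hru
      (by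
        intro x hx hxu hxw
        apply hnsep
        rintro (h1 | h1 | h1 | h1)
        · exact hF.notMem x h1 hx
        · exact hxu h1
        · exact hxw h1
        · exact hF.notMem_left (h1 ▸ hx)) with h1 | ⟨F', hF', hF'sep⟩
    · exact hQ h1
    · refine hQ (ih F'.ncard ?_ hF' rfl)
      rw [← hn]
      refine Set.ncard_lt_ncard ⟨fun x hx => ?_, fun hsub => hF'.notMem_right (hsub hy'F)⟩
      have hxs := hF'sep x hx
      by_contra hxF
      by_cases hxy : x = y
      · subst hxy
        rcases hxs.or_of_notMem (c := r₁) fun h1 => hr₁ (hZsub h1) with h1 | h1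
        · exact h1.not_adj hyr₁
        · exact hnsep r₁ hr₁ h1
      · refine hnsep x ?_ hxs
        rintro (h1 | h1 | h1 | h1)
        · exact hxF h1
        · exact hF'.notMem x hx (h1 ▸ hu)
        · exact hF'.notMem x hx (h1 ▸ hw)
        · exact hxy h1
  have h1 := h.ncard_inter_le hW hu hw huw hF.nonempty hF.notMem hF.notMem_left hF.notMem_right hcl
    hF.rest hr₁ hyr₁ hTu hTw hZ
  have hswap : ({w, u, y} : Set V) = {u, w, y} := Set.insert_comm _ _ _
  have h2 := h.ncard_inter_le hW (r₀ := r₁) (y := y) (F := F) hw hu huw.symm hF.nonempty hF.notMem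
    hF.notMem_left
    hF.notMem_right (fun f hf x hx => by have := hcl f hf x hx; tauto) (hswap ▸ hF.rest)
    (hswap ▸ hr₁) hyr₁ hTw hTu (by rw [Set.pair_comm]; exact hZ)
  have h2' := h2.2 (hswap ▸ ⟨r, hr, hwr⟩)
  have hdom : ∀ d ∈ F, B.Adj d u ∨ B.Adj d w := by
    intro d hd
    obtain ⟨x, hx, hdx⟩ := h.exists_adj_mem hW d
    rcases hcl d hd x hdx with h3 | rfl | rfl | rfl
    · exact (hF.notMem x h3 hx).elim
    · exact Or.inl hdx
    · exact Or.inr hdx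
    · exact (hF.notMem_left hx).elim
  -- The chain `|F ∩ Tw| + 1 ≤ |F ∖ Tw| ≤ |F ∩ Tu| ≤ |F ∖ Tu| ≤ |F ∩ Tw|` is absurd.
  have h3 : (F \ Tw).ncard ≤ (F ∩ Tu).ncard := Set.ncard_le_ncard fun d hd =>
    ⟨hd.1, hTu.adj_mem d ((hdom d hd.1).resolve_right fun h4 => hd.2 (hTw.adj_mem d h4.symm)).symm⟩
  have h4 : (F \ Tu).ncard ≤ (F ∩ Tw).ncard := Set.ncard_le_ncard fun d hd =>
    ⟨hd.1, hTw.adj_mem d ((hdom d hd.1).resolve_left fun h4 => hd.2 (hTu.adj_mem d h4.symm)).symm⟩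
  omega

end IsAccessibleBlock

end Pocket

/-! ### Three whiskers: some vertex has no obstruction -/

section ThreeWhiskers

variable {V : Type*} {B : SimpleGraph V} {W : Set V}

namespace IsAccessibleBlock

variable [Finite V] (h : IsAccessibleBlock B W)
include h

/-- A cutset inside `W` leaves `B ∖ T` connected, but an obstruction isolates `v` from the remaining
neighbour of a vertex of `W`. -/
lemma sdiff_nonempty_of_isObstruction (hW : W.Nontrivial) {v : V} {T : Set V}
    (hT : IsObstruction B W v T) : (T \ W).Nonempty := by
  by_contra hne
  have h1 := h.unmixed T hT.isWhiskerCutset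
  rw [Set.not_nonempty_iff_eq_empty.1 hne, Set.ncard_empty] at h1
  obtain ⟨w, hw, hvw⟩ := h.exists_adj_mem hW v
  obtain ⟨b, hb, hbv, -⟩ := hT.whisker w (hT.adj_mem w hvw) hw
  have h2 := two_le_numComponents (G := B) (T := T) (a := v) (b := b)
    ⟨hT.notMem, hb, {v}, rfl, hbv, fun x hx y hxy => Or.inr (hT.adj_mem y (by
      rw [Set.mem_singleton_iff] at hx
      exact hx ▸ hxy))⟩
  omega

lemma isPendantAt_of_isObstruction {a b m : V} (hWe : W = {a, b, m}) (hab : a ≠ b)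
    (hma : B.Adj m a) (hmb : B.Adj m b) {Ta Tb Tm : Set V} (hTa : IsObstruction B W a Ta)
    (hTb : IsObstruction B W b Tb) (hTm : IsObstruction B W m Tm) : IsPendantAt B W b m := by
  have haW : a ∈ W := by simp [hWe]
  have hbW : b ∈ W := by simp [hWe]
  have hmW : m ∈ W := by simp [hWe]
  have hW : W.Nontrivial := ⟨a, haW, b, hbW, hab⟩
  obtain ⟨y, hy, W', hW', hne, hcut⟩ := h.exists_insert hTa.isWhiskerCutset
    (h.sdiff_nonempty_of_isObstruction hW hTa)
  have haZ : a ∉ insert y W' := by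
    rintro (h1 | h1)
    · exact hy.2 (h1 ▸ haW)
    · exact hTa.notMem (hW' h1).1
  have hsub : W' ⊆ {b, m} := by
    intro x hx
    have h1 := (hW' hx).2
    rw [hWe] at h1
    refine h1.resolve_left ?_
    rintro rfl
    exact haZ (Or.inr hx)
  rcases h.pendant_or_pocket hW hy.2 hsub hne hcut hTb hTm hma haZ hab (by
    intro x hx hxb hxm
    rw [hWe] at hx
    rcases hx with rfl | hx | hx
    · exact not_sep_self _
    · exact (hxb hx).elim
    · exact (hxm hx).elim) with h1 | ⟨F, hF, -⟩
  · exact h1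
  · exact h.isPendantAt_of_isPocket hW hbW hmW hmb.symm hTb hTm hF

/-- Both `a` and `b` are pendant at `m`, with further neighbours `p` and `q`. The part `F` cut off
from `m` by the stripped obstruction of `m` consists of `p` and `q` alone, since each of its
vertices is adjacent to `a` or `b`. -/
lemma false_of_isObstruction_of_adj {a b m : V} (hWe : W = {a, b, m}) (hab : a ≠ b)
    (hma : B.Adj m a) (hmb : B.Adj m b) {Ta Tb Tm : Set V} (hTa : IsObstruction B W a Ta)
    (hTb : IsObstruction B W b Tb) (hTm : IsObstruction B W m Tm) : False := by
  have haW : a ∈ W := by simp [hWe]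
  have hbW : b ∈ W := by simp [hWe]
  have hmW : m ∈ W := by simp [hWe]
  have hW : W.Nontrivial := ⟨a, haW, b, hbW, hab⟩
  obtain ⟨p, hpW, hp⟩ := h.isPendantAt_of_isObstruction
    (show W = {b, a, m} by rw [hWe, Set.insert_comm]) hab.symm hmb hma hTb hTa hTm
  obtain ⟨q, hqW, hq⟩ := h.isPendantAt_of_isObstruction hWe hab hma hmb hTa hTb hTm
  obtain ⟨y, hy, W', hW', hne, hcut⟩ := h.exists_insert hTm.isWhiskerCutset
    (h.sdiff_nonempty_of_isObstruction hW hTm)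
  have hmZ : m ∉ insert y W' := by
    rintro (h1 | h1)
    · exact hy.2 (h1 ▸ hmW)
    · exact hTm.notMem (hW' h1).1
  have hsub : ∀ x ∈ insert y W', x = a ∨ x = b ∨ x = y := by
    rintro x (rfl | hx)
    · simp
    · have h1 := (hW' hx).2
      rw [hWe] at h1
      rcases h1 with h1 | h1 | h1
      · exact Or.inl h1
      · exact Or.inr (Or.inl h1)
      · exact (hmZ (Or.inr (h1 ▸ hx))).elim
  set Z := insert y W' with hZ
  have hyZ : y ∈ Z := Or.inl rfl
  set F : Set V := {x | Sep B Z x m} with hFdef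
  have hclosed : ∀ x ∈ F, ∀ v, B.Adj x v → v ∈ F ∨ v ∈ Z := by
    intro x hx v hxv
    by_cases hv : v ∈ Z
    · exact Or.inr hv
    · exact Or.inl ((Sep.or_of_notMem hx hv).resolve_left fun h => h.not_adj hxv)
  have hF : F.Nonempty := by
    obtain ⟨b₁, b₂, -, -, hs⟩ := (hcut y hyZ).2 hy.2
    rcases hs.or_of_notMem hmZ with h | h
    · exact ⟨_, h⟩
    · exact ⟨_, h.symm⟩
  have hmF : m ∉ F := fun h => h.ne rfl
  have hFW : ∀ x ∈ F, x ∉ W := by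
    intro x hx hxW
    rw [hWe] at hxW
    rcases hxW with rfl | rfl | rfl
    · exact Sep.not_adj hx hma.symm
    · exact Sep.not_adj hx hmb.symm
    · exact hmF hx
  have hcl : ∀ f ∈ F, ∀ x, B.Adj f x → x ∈ F ∨ x = a ∨ x = b ∨ x = y := fun f hf x hfx =>
    (hclosed f hf x hfx).imp id (hsub x)
  have hFa : ∃ f ∈ F, B.Adj a f := by
    by_contra hc
    push Not at hc
    refine h.not_isObstruction hW (u := b) (y := y) hF hFW hy.2 (fun f hf x hfx => ?_) hTb
    refine (hcl f hf x hfx).imp id fun h1 => h1.resolve_left ?_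
    rintro rfl
    exact hc f hf hfx.symm
  have hFb : ∃ f ∈ F, B.Adj b f := by
    by_contra hc
    push Not at hc
    refine h.not_isObstruction hW (u := a) (y := y) hF hFW hy.2 (fun f hf x hfx => ?_) hTa
    refine (hcl f hf x hfx).imp id fun h1 => ?_
    rcases h1 with h1 | rfl | h1
    · exact Or.inl h1
    · exact (hc f hf hfx.symm).elim
    · exact Or.inr h1
  have hFpq : ∀ f ∈ F, f = p ∨ f = q := by
    intro f hf
    obtain ⟨w, hw, hfw⟩ := h.exists_adj_mem hW f
    have hfm : f ≠ m := fun h1 => hmF (h1 ▸ hf)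
    rcases hcl f hf w hfw with h1 | rfl | rfl | rfl
    · exact (hFW w h1 hw).elim
    · exact Or.inl ((hp f hfw.symm).resolve_left hfm)
    · exact Or.inr ((hq f hfw.symm).resolve_left hfm)
    · exact (hy.2 hw).elim
  obtain ⟨hpF, hap⟩ : p ∈ F ∧ B.Adj a p := by
    obtain ⟨f, hf, haf⟩ := hFa
    have := (hp f haf).resolve_left fun h1 => hmF (h1 ▸ hf)
    exact ⟨this ▸ hf, this ▸ haf⟩
  obtain ⟨hqF, hbq⟩ : q ∈ F ∧ B.Adj b q := by
    obtain ⟨f, hf, hbf⟩ := hFb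
    have := (hq f hbf).resolve_left fun h1 => hmF (h1 ▸ hf)
    exact ⟨this ▸ hf, this ▸ hbf⟩
  have hyF : y ∉ F := fun h1 => h1.1 hyZ
  have hym : y ≠ m := fun h1 => hy.2 (h1 ▸ hmW)
  have hya : y ≠ a := fun h1 => hy.2 (h1 ▸ haW)
  have hyb : y ≠ b := fun h1 => hy.2 (h1 ▸ hbW)
  have hpm : p ≠ m := fun h1 => hmF (h1 ▸ hpF)
  have hqm : q ≠ m := fun h1 => hmF (h1 ▸ hqF)
  -- If `p = q`, the cutset `{m, p}` separates `a`, `b` and `y` pairwise, yet unmixedness permits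
  -- two components.
  by_cases hpq : p = q
  · subst hpq
    have hyp : y ≠ p := fun h1 => hyF (h1 ▸ hpF)
    have hap' : a ≠ p := hap.ne
    have hbp' : b ≠ p := hbq.ne
    have hsep1 : ∀ x, x ≠ a → x ≠ m → x ≠ p → Sep B {m, p} a x := by
      intro x hxa hxm hxp
      refine ⟨by simp [hap', hma.ne'], by simp [hxm, hxp], {a}, rfl, hxa, ?_⟩
      rintro _ rfl v hv
      exact Or.inr (hp v hv)
    have hsep2 : Sep B {m, p} b y := by
      refine ⟨by simp [hbp', hmb.ne'], by simp [hym, hyp], {b}, rfl, hyb, ?_⟩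
      rintro _ rfl v hv
      exact Or.inr (hq v hv)
    have h3 := three_le_numComponents (hsep1 b hab.symm hmb.ne' hbp') (hsep1 y hya hym hyp) hsep2
    have hcut2 : IsWhiskerCutset B W {m, p} := by
      rintro t (rfl | rfl)
      · exact ⟨fun _ => ⟨a, by simp [hap', hma.ne'], hma⟩, fun h1 => (h1 hmW).elim⟩
      · exact ⟨fun h1 => (hpW h1).elim, fun _ =>
          ⟨a, b, hap.symm, hbq.symm, hsep1 b hab.symm hmb.ne' hbp'⟩⟩
    have h4 := h.unmixed _ hcut2
    have h5 : (({m, p} : Set V) \ W).ncard ≤ ({p} : Set V).ncard := Set.ncard_le_ncard (by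
      rintro x ⟨rfl | hx, hxW⟩
      · exact (hxW hmW).elim
      · exact hx)
    rw [Set.ncard_singleton] at h5
    omega
  · have hpadj : ∀ x, B.Adj p x → x ≠ a → x = q ∨ x = y := by
      intro x hx hxa
      rcases hcl p hpF x hx with h1 | rfl | rfl | h1
      · exact Or.inl ((hFpq x h1).resolve_left hx.ne')
      · exact (hxa rfl).elim
      · exact ((hq p hx.symm).elim hpm hpq).elim
      · exact Or.inr h1
    have hqadj : ∀ x, B.Adj q x → x ≠ b → x = p ∨ x = y := by
      intro x hx hxb
      rcases hcl q hqF x hx with h1 | rfl | rfl | h1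
      · exact Or.inl ((hFpq x h1).resolve_right hx.ne')
      · exact ((hp q hx.symm).elim hqm fun h1 => hpq h1.symm).elim
      · exact (hxb rfl).elim
      · exact Or.inr h1
    -- Apart from `a`, the vertex `p ∈ Ta` can only have the neighbours `q` and `y`, so `Ta` must
    -- separate these two. But `q ∈ Tb` likewise needs `y` as a neighbour, making them adjacent.
    obtain ⟨b₁, b₂, n1, n2, a1, a2, hs⟩ := hTa.joins p (hTa.adj_mem p hap) hpW
    obtain ⟨c₁, c₂, n3, n4, a3, a4, hs'⟩ := hTb.joins q (hTb.adj_mem q hbq) hqW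
    have hqy : B.Adj q y := by
      rcases hqadj c₁ a3 n3 with rfl | rfl
      · rcases hqadj c₂ a4 n4 with rfl | rfl
        · exact (hs'.ne rfl).elim
        · exact a4
      · exact a3
    rcases hpadj b₁ a1 n1 with rfl | rfl <;> rcases hpadj b₂ a2 n2 with rfl | rfl
    · exact hs.ne rfl
    · exact hs.not_adj hqy
    · exact hs.not_adj hqy.symm
    · exact hs.ne rfl

theorem exists_forall_not_isObstruction (hW : W.ncard = 3) :
    ∃ w ∈ W, ∀ T, ¬ IsObstruction B W w T := by
  by_contra hc
  push Not at hc
  obtain ⟨a, b, c, hab, hac, hbc, hWe⟩ := Set.ncard_eq_three.1 hW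
  have haW : a ∈ W := by simp [hWe]
  have hbW : b ∈ W := by simp [hWe]
  have hcW : c ∈ W := by simp [hWe]
  obtain ⟨Ta, hTa⟩ := hc a haW
  obtain ⟨Tb, hTb⟩ := hc b hbW
  obtain ⟨Tc, hTc⟩ := hc c hcW
  have hadj := h.exists_adj_mem ⟨a, haW, b, hbW, hab⟩
  have e1 : W = {b, c, a} := by rw [hWe]; ext; simp; tauto
  have e2 : W = {a, c, b} := by rw [hWe]; ext; simp; tauto
  have hA : B.Adj a b → B.Adj a c → False := fun h1 h2 =>
    h.false_of_isObstruction_of_adj e1 hbc h1 h2 hTb hTc hTa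
  have hB : B.Adj b a → B.Adj b c → False := fun h1 h2 =>
    h.false_of_isObstruction_of_adj e2 hac h1 h2 hTa hTc hTb
  have hC : B.Adj c a → B.Adj c b → False := fun h1 h2 =>
    h.false_of_isObstruction_of_adj hWe hab h1 h2 hTa hTb hTc
  -- Three vertices, each adjacent to another of the three, always include one adjacent to both
  -- others.
  have key : ∀ x, B.Adj x a ∨ B.Adj x b ∨ B.Adj x c := by
    intro x
    obtain ⟨w, hw, hxw⟩ := hadj x
    rw [hWe] at hw
    rcases hw with rfl | rfl | rfl <;> tauto
  have ka := key a
  have kb := key b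
  have kc := key c
  simp only [SimpleGraph.irrefl, false_or, or_false, B.adj_comm b a, B.adj_comm c a,
    B.adj_comm c b] at ka kb kc hA hB hC
  tauto

end IsAccessibleBlock

end ThreeWhiskers

/-! ### Primes generated by variables and minors, and their heights -/

section Algebra

open MvPolynomial

variable {V : Type*} {K : Type*} [Field K]

/-- The binomial `x_i y_j - x_j y_i`. -/
noncomputable def minor (K : Type*) [Field K] {V : Type*} (i j : V) : MvPolynomial (V ⊕ V) K :=
  X (Sum.inl i) * X (Sum.inr j) - X (Sum.inl j) * X (Sum.inr i)

open Classical in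
/-- The homomorphism sending `x_v`, `y_v` to `0` for `v ∈ T`, and to `a_v s_{ℓ v}`, `a_v t_{ℓ v}`
otherwise. -/
noncomputable def labelHom (K : Type*) [Field K] {V : Type*} (ℓ : V → V) (T : Set V) :
    MvPolynomial (V ⊕ V) K →ₐ[K] MvPolynomial (V ⊕ V ⊕ V) K :=
  aeval (Sum.elim
    (fun v => if v ∈ T then 0 else X (Sum.inl v) * X (Sum.inr (Sum.inl (ℓ v))))
    (fun v => if v ∈ T then 0 else X (Sum.inl v) * X (Sum.inr (Sum.inr (ℓ v)))))

/-- The kernel of `labelHom`. It is the smallest prime ideal containing the variables of the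
vertices in `T` and the `2`-minors of the vertices outside `T` with equal labels. -/
noncomputable def labelIdeal (K : Type*) [Field K] {V : Type*} (ℓ : V → V) (T : Set V) :
    Ideal (MvPolynomial (V ⊕ V) K) :=
  RingHom.ker (labelHom K ℓ T)

variable {ℓ : V → V} {T : Set V}

instance labelIdeal_isPrime : (labelIdeal K ℓ T).IsPrime := RingHom.ker_isPrime _

lemma labelHom_inl_of_mem {v : V} (hv : v ∈ T) : labelHom K ℓ T (X (Sum.inl v)) = 0 := by
  simp [labelHom, hv]

lemma labelHom_inr_of_mem {v : V} (hv : v ∈ T) : labelHom K ℓ T (X (Sum.inr v)) = 0 := by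
  simp [labelHom, hv]

lemma labelHom_inl_of_notMem {v : V} (hv : v ∉ T) :
    labelHom K ℓ T (X (Sum.inl v)) = X (Sum.inl v) * X (Sum.inr (Sum.inl (ℓ v))) := by
  simp [labelHom, hv]

lemma labelHom_inr_of_notMem {v : V} (hv : v ∉ T) :
    labelHom K ℓ T (X (Sum.inr v)) = X (Sum.inl v) * X (Sum.inr (Sum.inr (ℓ v))) := by
  simp [labelHom, hv]

lemma X_inl_mem_labelIdeal {v : V} : X (Sum.inl v) ∈ labelIdeal K ℓ T ↔ v ∈ T := by
  rw [labelIdeal, RingHom.mem_ker]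
  by_cases hv : v ∈ T
  · simp [hv, labelHom_inl_of_mem]
  · simp [hv, labelHom_inl_of_notMem, X_ne_zero]

lemma X_inr_mem_labelIdeal {v : V} : X (Sum.inr v) ∈ labelIdeal K ℓ T ↔ v ∈ T := by
  rw [labelIdeal, RingHom.mem_ker]
  by_cases hv : v ∈ T
  · simp [hv, labelHom_inr_of_mem]
  · simp [hv, labelHom_inr_of_notMem, X_ne_zero]

lemma minor_mem_of_mem {I : Ideal (MvPolynomial (V ⊕ V) K)} {i j : V}
    (h : (X (Sum.inl i) ∈ I ∧ X (Sum.inr i) ∈ I) ∨ (X (Sum.inl j) ∈ I ∧ X (Sum.inr j) ∈ I)) :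
    minor K i j ∈ I := by
  rcases h with h | h
  · exact I.sub_mem (I.mul_mem_right _ h.1) (I.mul_mem_left _ h.2)
  · exact I.sub_mem (I.mul_mem_left _ h.2) (I.mul_mem_right _ h.1)

lemma minor_comm_mem {I : Ideal (MvPolynomial (V ⊕ V) K)} {i j : V} (h : minor K i j ∈ I) :
    minor K j i ∈ I := by
  have : minor K j i = - minor K i j := by simp [minor]
  exact this ▸ I.neg_mem h

lemma minor_self (i : V) : minor K i i = 0 := sub_self _

lemma minor_mem_labelIdeal {i j : V} :
    minor K i j ∈ labelIdeal K ℓ T ↔ i ∈ T ∨ j ∈ T ∨ ℓ i = ℓ j := by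
  by_cases hi : i ∈ T
  · simp only [hi, true_or, iff_true]
    exact minor_mem_of_mem (Or.inl ⟨X_inl_mem_labelIdeal.2 hi, X_inr_mem_labelIdeal.2 hi⟩)
  by_cases hj : j ∈ T
  · simp only [hj, true_or, or_true, iff_true]
    exact minor_mem_of_mem (Or.inr ⟨X_inl_mem_labelIdeal.2 hj, X_inr_mem_labelIdeal.2 hj⟩)
  simp only [hi, hj, false_or, labelIdeal, RingHom.mem_ker, minor, map_sub, map_mul,
    labelHom_inl_of_notMem hi, labelHom_inl_of_notMem hj, labelHom_inr_of_notMem hi,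
    labelHom_inr_of_notMem hj]
  constructor
  · intro h
    classical
    by_contra hne
    -- With `s` the indicator of the label of `i` and `t` that of the label of `j`, the image of the
    -- minor takes the value `1`.
    have := congrArg (aeval (R := K) (S₁ := K) (Sum.elim (fun _ => 1)
      (Sum.elim (fun c => if c = ℓ i then 1 else 0) (fun c => if c = ℓ j then 1 else 0)))) h
    simp [Ne.symm hne] at this
  · intro h
    rw [h]
    ring

/-- Pairwise proportional vectors of length two are multiples of a single vector. -/
lemma exists_common_vector {ι L : Type*} [Field L] (p q : ι → L) (S : Set ι)
    (h : ∀ i ∈ S, ∀ j ∈ S, p i * q j = p j * q i) :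
    ∃ s t : L, ∀ i ∈ S, ∃ a, p i = a * s ∧ q i = a * t := by
  by_cases hex : ∃ i ∈ S, p i ≠ 0 ∨ q i ≠ 0
  · obtain ⟨i, hi, hpq⟩ := hex
    refine ⟨p i, q i, fun j hj => ?_⟩
    rcases hpq with hp | hq
    · refine ⟨p j / p i, by field_simp, ?_⟩
      have := h i hi j hj
      field_simp
      linear_combination this
    · refine ⟨q j / q i, ?_, by field_simp⟩
      have := h i hi j hj
      field_simp
      linear_combination -this
  · push Not at hex
    exact ⟨0, 0, fun i hi => ⟨0, by simp [hex i hi]⟩⟩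

/-- Over the fraction field of the quotient by `Q`, the vectors `(x_v, y_v)` with a common label are
multiples of one vector. Hence the quotient map factors through `labelHom`, and its kernel contains
that of `labelHom`. -/
lemma labelIdeal_le {Q : Ideal (MvPolynomial (V ⊕ V) K)} [hQ : Q.IsPrime]
    (hT : ∀ v ∈ T, X (Sum.inl v) ∈ Q ∧ X (Sum.inr v) ∈ Q)
    (hm : ∀ i j, i ∉ T → j ∉ T → ℓ i = ℓ j → minor K i j ∈ Q) : labelIdeal K ℓ T ≤ Q := by
  set L := FractionRing (MvPolynomial (V ⊕ V) K ⧸ Q)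
  let ψ : MvPolynomial (V ⊕ V) K →ₐ[K] L :=
    (IsScalarTower.toAlgHom K (MvPolynomial (V ⊕ V) K ⧸ Q) L).comp (Ideal.Quotient.mkₐ K Q)
  have hψ : ∀ f, ψ f = 0 ↔ f ∈ Q := by
    intro f
    change algebraMap (MvPolynomial (V ⊕ V) K ⧸ Q) L (Ideal.Quotient.mk Q f) = 0 ↔ _
    rw [FaithfulSMul.algebraMap_eq_zero_iff, Ideal.Quotient.eq_zero_iff_mem]
  have hex : ∀ c : V, ∃ s t : L, ∀ i ∈ {v | v ∉ T ∧ ℓ v = c}, ∃ a,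
      ψ (X (Sum.inl i)) = a * s ∧ ψ (X (Sum.inr i)) = a * t := by
    intro c
    refine exists_common_vector (fun v => ψ (X (Sum.inl v))) (fun v => ψ (X (Sum.inr v))) _ ?_
    rintro i ⟨hi, rfl⟩ j ⟨hj, hij⟩
    have := (hψ _).2 (hm i j hi hj hij.symm)
    rw [minor, map_sub, map_mul, map_mul, sub_eq_zero] at this
    exact this
  choose s t hst using hex
  have hex2 : ∀ v : V, ∃ a : L, v ∉ T → ψ (X (Sum.inl v)) = a * s (ℓ v) ∧
      ψ (X (Sum.inr v)) = a * t (ℓ v) := by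
    intro v
    by_cases hv : v ∈ T
    · exact ⟨0, fun h => (h hv).elim⟩
    · obtain ⟨a, ha⟩ := hst (ℓ v) v ⟨hv, rfl⟩
      exact ⟨a, fun _ => ha⟩
  choose a ha using hex2
  have hfac : ψ = (aeval (Sum.elim a (Sum.elim s t))).comp (labelHom K ℓ T) := by
    refine MvPolynomial.algHom_ext fun v => ?_
    rcases v with v | v
    · by_cases hv : v ∈ T
      · simp [labelHom_inl_of_mem hv, (hψ _).2 (hT v hv).1]
      · simp [labelHom_inl_of_notMem hv, (ha v hv).1]
    · by_cases hv : v ∈ T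
      · simp [labelHom_inr_of_mem hv, (hψ _).2 (hT v hv).2]
      · simp [labelHom_inr_of_notMem hv, (ha v hv).2]
  intro f hf
  rw [← hψ, hfac, AlgHom.comp_apply, (RingHom.mem_ker).1 hf, map_zero]

/-- Transitivity of proportionality modulo a prime ideal. -/
lemma minor_mem_trans {Q : Ideal (MvPolynomial (V ⊕ V) K)} [hQ : Q.IsPrime] {i k j : V}
    (hk : ¬ (X (Sum.inl k) ∈ Q ∧ X (Sum.inr k) ∈ Q)) (h1 : minor K i k ∈ Q)
    (h2 : minor K k j ∈ Q) : minor K i j ∈ Q := by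
  have e1 : X (Sum.inl k) * minor K i j
      = X (Sum.inl i) * minor K k j + X (Sum.inl j) * minor K i k := by
    simp only [minor]; ring
  have e2 : X (Sum.inr k) * minor K i j
      = X (Sum.inr j) * minor K i k + X (Sum.inr i) * minor K k j := by
    simp only [minor]; ring
  have m1 : X (Sum.inl k) * minor K i j ∈ Q :=
    e1 ▸ Q.add_mem (Q.mul_mem_left _ h2) (Q.mul_mem_left _ h1)
  have m2 : X (Sum.inr k) * minor K i j ∈ Q :=
    e2 ▸ Q.add_mem (Q.mul_mem_left _ h1) (Q.mul_mem_left _ h2)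
  rcases hQ.mem_or_mem m1 with h | h
  · rcases hQ.mem_or_mem m2 with h' | h'
    · exact (hk ⟨h, h'⟩).elim
    · exact h'
  · exact h

open Classical in
/-- Setting both variables of an isolated vertex to zero raises the height by two. -/
lemma height_labelIdeal_add_two_le {ℓ' : V → V} {v : V} (hvT : v ∉ T) (hv : ℓ v = v)
    (hne : ∀ u, u ≠ v → u ∉ T → ℓ u ≠ v) (hℓ' : ∀ u, u ≠ v → ℓ' u = ℓ u) :
    (labelIdeal K ℓ T).height + 1 + 1 ≤ (labelIdeal K ℓ' (insert v T)).height := by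
  -- The map `ρ` sets `s_v = 0` and `σ` sets `a_v = 0`. The kernel of `ρ.comp φ` is the intermediate
  -- prime: it contains `x_v` but not `y_v`.
  let ρ : MvPolynomial (V ⊕ V ⊕ V) K →ₐ[K] MvPolynomial (V ⊕ V ⊕ V) K :=
    aeval (fun z => if z = Sum.inr (Sum.inl v) then 0 else X z)
  let σ : MvPolynomial (V ⊕ V ⊕ V) K →ₐ[K] MvPolynomial (V ⊕ V ⊕ V) K :=
    aeval (fun z => if z = Sum.inl v then 0 else X z)
  set φ := labelHom K ℓ T with hφ
  let Q := RingHom.ker (ρ.comp φ)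
  have hQ : Q.IsPrime := RingHom.ker_isPrime _
  have hφv1 : φ (X (Sum.inl v)) = X (Sum.inl v) * X (Sum.inr (Sum.inl v)) := by
    rw [hφ, labelHom_inl_of_notMem hvT, hv]
  have hφv2 : φ (X (Sum.inr v)) = X (Sum.inl v) * X (Sum.inr (Sum.inr v)) := by
    rw [hφ, labelHom_inr_of_notMem hvT, hv]
  have hlt1 : labelIdeal K ℓ T < Q := by
    refine lt_of_le_of_ne (fun f hf => ?_) fun he => ?_
    · rw [RingHom.mem_ker, AlgHom.comp_apply]
      have : φ f = 0 := hf
      rw [this, map_zero]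
    · have : X (Sum.inl v) ∈ Q := by
        rw [RingHom.mem_ker, AlgHom.comp_apply, hφv1]
        simp [ρ]
      rw [← he, X_inl_mem_labelIdeal] at this
      exact hvT this
  have hvT' : v ∈ insert v T := Set.mem_insert _ _
  have hfac : labelHom K ℓ' (insert v T) = σ.comp (ρ.comp φ) := by
    refine MvPolynomial.algHom_ext fun u => ?_
    rcases u with u | u
    · by_cases huv : u = v
      · subst huv
        simp only [AlgHom.comp_apply, hφv1, labelHom_inl_of_mem hvT']
        simp [ρ]
      · by_cases huT : u ∈ T
        · simp only [AlgHom.comp_apply, hφ, labelHom_inl_of_mem huT,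
            labelHom_inl_of_mem (Set.mem_insert_of_mem v huT), map_zero]
        · have huT' : u ∉ insert v T := fun h => huT (h.resolve_left huv)
          simp only [AlgHom.comp_apply, hφ, labelHom_inl_of_notMem huT,
            labelHom_inl_of_notMem huT', hℓ' u huv]
          simp [ρ, σ, hne u huv huT, huv]
    · by_cases huv : u = v
      · subst huv
        simp only [AlgHom.comp_apply, hφv2, labelHom_inr_of_mem hvT']
        simp [ρ, σ]
      · by_cases huT : u ∈ T
        · simp only [AlgHom.comp_apply, hφ, labelHom_inr_of_mem huT,
            labelHom_inr_of_mem (Set.mem_insert_of_mem v huT), map_zero]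
        · have huT' : u ∉ insert v T := fun h => huT (h.resolve_left huv)
          simp only [AlgHom.comp_apply, hφ, labelHom_inr_of_notMem huT,
            labelHom_inr_of_notMem huT', hℓ' u huv]
          simp [ρ, σ, huv]
  have hlt2 : Q < labelIdeal K ℓ' (insert v T) := by
    refine lt_of_le_of_ne (fun f hf => ?_) fun he => ?_
    · rw [labelIdeal, RingHom.mem_ker, hfac, AlgHom.comp_apply]
      have : (ρ.comp φ) f = 0 := hf
      rw [this, map_zero]
    · have : X (Sum.inr v) ∈ Q := by
        rw [he, X_inr_mem_labelIdeal]
        exact hvT'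
      rw [RingHom.mem_ker, AlgHom.comp_apply, hφv2] at this
      simp [ρ, X_ne_zero] at this
  exact (add_le_add_left (Ideal.height_add_one_le_of_lt_of_isPrime hlt1) 1).trans
    (Ideal.height_add_one_le_of_lt_of_isPrime hlt2)

open Classical in
/-- The labelling which agrees with `ℓ` on `S`, and gives all other vertices labels of their own. -/
noncomputable def partialLabel (ℓ : V → V) (S : Set V) (v : V) : V := if v ∈ S then ℓ v else v

lemma partialLabel_of_mem {S : Set V} {v : V} (hv : v ∈ S) : partialLabel ℓ S v = ℓ v := if_pos hv

lemma partialLabel_of_notMem {S : Set V} {v : V} (hv : v ∉ S) : partialLabel ℓ S v = v := if_neg hv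

lemma partialLabel_insert {S : Set V} {u v : V} (h : u ≠ v) :
    partialLabel ℓ (insert v S) u = partialLabel ℓ S u := by
  by_cases hu : u ∈ S
  · rw [partialLabel_of_mem hu, partialLabel_of_mem (Set.mem_insert_of_mem v hu)]
  · rw [partialLabel_of_notMem hu, partialLabel_of_notMem fun h' => hu (h'.resolve_left h)]

section Height

variable [Finite V]

/-- Krull's height theorem: the ideal is minimal over the variables of `T` together with one minor
for each vertex outside `T` that is not its own label. -/
lemma height_labelIdeal_le (hℓ : ∀ v, v ∉ T → ℓ v ∉ T ∧ ℓ (ℓ v) = ℓ v) :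
    (labelIdeal K ℓ T).height ≤ ((2 * T.ncard + {v | v ∉ T ∧ ℓ v ≠ v}.ncard : ℕ) : ℕ∞) := by
  set S : Set (MvPolynomial (V ⊕ V) K) :=
    ((fun v => X (Sum.inl v)) '' T ∪ (fun v => X (Sum.inr v)) '' T) ∪
      (fun v => minor K (ℓ v) v) '' {v | v ∉ T ∧ ℓ v ≠ v} with hS
  have hfin : S.Finite :=
    ((Set.toFinite _).union (Set.toFinite _)).union ((Set.toFinite _).image _)
  have hcard : S.ncard ≤ 2 * T.ncard + {v | v ∉ T ∧ ℓ v ≠ v}.ncard := by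
    refine (Set.ncard_union_le _ _).trans (add_le_add ?_ (Set.ncard_image_le (Set.toFinite _)))
    refine (Set.ncard_union_le _ _).trans ?_
    rw [two_mul]
    exact add_le_add (Set.ncard_image_le (Set.toFinite _)) (Set.ncard_image_le (Set.toFinite _))
  refine le_trans (Ideal.height_le_card_of_mem_minimalPrimes_span hfin ?_)
    (Nat.cast_le.2 hcard)
  refine ⟨⟨inferInstance, Ideal.span_le.2 ?_⟩, ?_⟩
  · rintro f ((⟨v, hv, rfl⟩ | ⟨v, hv, rfl⟩) | ⟨v, hv, rfl⟩)
    · exact X_inl_mem_labelIdeal.2 hv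
    · exact X_inr_mem_labelIdeal.2 hv
    · exact minor_mem_labelIdeal.2 (Or.inr (Or.inr (hℓ v hv.1).2))
  · rintro Q ⟨hQ, hSQ⟩ hle
    have hroot : ∀ v, v ∉ T → minor K (ℓ v) v ∈ Q := by
      intro v hv
      by_cases hvℓ : ℓ v = v
      · rw [hvℓ, minor_self]; exact Q.zero_mem
      · exact hSQ (Ideal.subset_span (Or.inr ⟨v, ⟨hv, hvℓ⟩, rfl⟩))
    refine labelIdeal_le (fun v hv => ⟨hSQ (Ideal.subset_span (Or.inl (Or.inl ⟨v, hv, rfl⟩))),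
      hSQ (Ideal.subset_span (Or.inl (Or.inr ⟨v, hv, rfl⟩)))⟩) fun i j hi hj hij => ?_
    -- The variables of the representative `ℓ i` are not in `Q`, because `Q` lies below the label
    -- ideal and `ℓ i ∉ T`.
    refine minor_mem_trans (k := ℓ i) (fun h => (hℓ i hi).1 (X_inl_mem_labelIdeal.1 (hle h.1)))
      (minor_comm_mem (hroot i hi)) (hij ▸ hroot j hj)

lemma le_height_labelIdeal (hℓ : ∀ v, v ∉ T → ℓ v ∉ T ∧ ℓ (ℓ v) = ℓ v) :
    ((2 * T.ncard + {v | v ∉ T ∧ ℓ v ≠ v}.ncard : ℕ) : ℕ∞) ≤ (labelIdeal K ℓ T).height := by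
  -- A chain of primes is built by activating the vertices one at a time, from the zero ideal up. A
  -- vertex of `T` contributes two steps, a vertex outside `T` with `ℓ v ≠ v` one step, and a fixed
  -- vertex outside `T` none.
  suffices H : ∀ S : Set V, ((2 * (T ∩ S).ncard + ({v | v ∉ T ∧ ℓ v ≠ v} ∩ S).ncard : ℕ) : ℕ∞) ≤
      (labelIdeal K (partialLabel ℓ S) (T ∩ S)).height by
    have h := H Set.univ
    rwa [Set.inter_univ, Set.inter_univ,
      show partialLabel ℓ Set.univ = ℓ from funext fun v => partialLabel_of_mem (Set.mem_univ v)]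
      at h
  intro S
  induction S, Set.toFinite S using Set.Finite.induction_on with
  | empty => simp
  | @insert v S hv _ ih =>
    by_cases hvT : v ∈ T
    · have hvTS : v ∉ T ∩ S := fun h => hv h.2
      have e0 : T ∩ insert v S = insert v (T ∩ S) := Set.inter_insert_of_mem hvT
      have e1 : (T ∩ insert v S).ncard = (T ∩ S).ncard + 1 := by
        rw [e0, Set.ncard_insert_of_notMem hvTS]
      have e2 : {v | v ∉ T ∧ ℓ v ≠ v} ∩ insert v S = {v | v ∉ T ∧ ℓ v ≠ v} ∩ S :=
        Set.inter_insert_of_notMem fun h => h.1 hvT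
      rw [e1, e2, e0]
      refine le_trans ?_ (height_labelIdeal_add_two_le hvTS (partialLabel_of_notMem hv)
        (fun u hu huT he => ?_) fun u hu => partialLabel_insert hu)
      · refine le_trans (le_of_eq ?_) (add_le_add_left (add_le_add_left ih 1) 1)
        push_cast
        ring
      · by_cases huS : u ∈ S
        · rw [partialLabel_of_mem huS] at he
          exact (hℓ u fun h => huT ⟨h, huS⟩).1 (he ▸ hvT)
        · rw [partialLabel_of_notMem huS] at he
          exact hu he
    · have hTS : T ∩ insert v S = T ∩ S := Set.inter_insert_of_notMem hvT
      rw [hTS]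
      have hle : labelIdeal K (partialLabel ℓ S) (T ∩ S) ≤
          labelIdeal K (partialLabel ℓ (insert v S)) (T ∩ S) := by
        refine labelIdeal_le (fun u hu => ⟨X_inl_mem_labelIdeal.2 hu, X_inr_mem_labelIdeal.2 hu⟩)
          fun i j hi hj hij => minor_mem_labelIdeal.2 (Or.inr (Or.inr ?_))
        have key : ∀ i, i ∉ T ∩ S → partialLabel ℓ (insert v S) i =
            partialLabel ℓ (insert v S) (partialLabel ℓ S i) := by
          intro i hi
          by_cases hiS : i ∈ S
          · have h1 := (hℓ i fun h => hi ⟨h, hiS⟩).2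
            rw [partialLabel_of_mem hiS, partialLabel_of_mem (Set.mem_insert_of_mem v hiS)]
            by_cases h2 : ℓ i ∈ insert v S
            · rw [partialLabel_of_mem h2, h1]
            · rw [partialLabel_of_notMem h2]
          · rw [partialLabel_of_notMem hiS]
        rw [key i hi, key j hj, hij]
      by_cases hvℓ : ℓ v = v
      · have e2 : {v | v ∉ T ∧ ℓ v ≠ v} ∩ insert v S = {v | v ∉ T ∧ ℓ v ≠ v} ∩ S :=
          Set.inter_insert_of_notMem fun h => h.2 hvℓ
        rw [e2]
        exact ih.trans (Ideal.height_mono hle)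
      · have e2 : ({v | v ∉ T ∧ ℓ v ≠ v} ∩ insert v S).ncard =
            ({v | v ∉ T ∧ ℓ v ≠ v} ∩ S).ncard + 1 := by
          rw [Set.inter_insert_of_mem (show v ∈ {v | v ∉ T ∧ ℓ v ≠ v} from ⟨hvT, hvℓ⟩),
            Set.ncard_insert_of_notMem fun h => hv h.2]
        have hfix : ∀ S, partialLabel ℓ S (ℓ v) = ℓ v := by
          intro S
          by_cases h2 : ℓ v ∈ S
          · rw [partialLabel_of_mem h2, (hℓ v hvT).2]
          · rw [partialLabel_of_notMem h2]
        have hne : labelIdeal K (partialLabel ℓ S) (T ∩ S) ≠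
            labelIdeal K (partialLabel ℓ (insert v S)) (T ∩ S) := by
          intro he
          have h1 : minor K v (ℓ v) ∈ labelIdeal K (partialLabel ℓ (insert v S)) (T ∩ S) := by
            refine minor_mem_labelIdeal.2 (Or.inr (Or.inr ?_))
            rw [hfix, partialLabel_of_mem (Set.mem_insert v S)]
          rw [← he, minor_mem_labelIdeal, hfix, partialLabel_of_notMem hv] at h1
          rcases h1 with h1 | h1 | h1
          · exact hvT h1.1
          · exact (hℓ v hvT).1 h1.1
          · exact hvℓ h1.symm
        have s1 := Ideal.height_add_one_le_of_lt_of_isPrime (lt_of_le_of_ne hle hne)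
        rw [e2]
        refine le_trans ?_ s1
        refine le_trans (le_of_eq ?_) (add_le_add_left ih 1)
        push_cast
        ring

lemma height_labelIdeal (hℓ : ∀ v, v ∉ T → ℓ v ∉ T ∧ ℓ (ℓ v) = ℓ v) :
    (labelIdeal K ℓ T).height = ((2 * T.ncard + {v | v ∉ T ∧ ℓ v ≠ v}.ncard : ℕ) : ℕ∞) :=
  le_antisymm (height_labelIdeal_le hℓ) (le_height_labelIdeal hℓ)

end Height

end Algebra

/-! ### Minimal primes of `J_G` and the cutset criterion for unmixedness -/

section Unmixed

open MvPolynomial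

variable {V : Type*} {K : Type*} [Field K] {G : SimpleGraph V} {T : Set V}

open Classical in
/-- A representative of the component of `v` in `G ∖ T`. -/
noncomputable def componentLabel (G : SimpleGraph V) (T : Set V) (v : V) : V :=
  if h : v ∈ Tᶜ then ((deleteSet G T).connectedComponentMk ⟨v, h⟩).out.1 else v

lemma componentLabel_notMem {v : V} (hv : v ∉ T) : componentLabel G T v ∉ T := by
  rw [componentLabel, dif_pos (show v ∈ Tᶜ from hv)]
  exact ((deleteSet G T).connectedComponentMk ⟨v, hv⟩).out.2

lemma not_sep_componentLabel {v : V} (hv : v ∉ T) : ¬ Sep G T v (componentLabel G T v) := by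
  rw [componentLabel, dif_pos (show v ∈ Tᶜ from hv)]
  rw [← connectedComponentMk_eq_iff ⟨v, hv⟩]
  exact (Quot.out_eq _).symm

lemma componentLabel_eq_iff {i j : V} (hi : i ∉ T) (hj : j ∉ T) :
    componentLabel G T i = componentLabel G T j ↔ ¬ Sep G T i j := by
  constructor
  · intro h hs
    rcases hs.or_of_notMem (componentLabel_notMem (G := G) hi) with h1 | h1
    · exact not_sep_componentLabel hi h1
    · exact not_sep_componentLabel hj (h ▸ h1.symm)
  · intro h
    have := (connectedComponentMk_eq_iff (G := G) (T := T) ⟨i, hi⟩ ⟨j, hj⟩).2 h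
    rw [componentLabel, componentLabel, dif_pos (show i ∈ Tᶜ from hi),
      dif_pos (show j ∈ Tᶜ from hj), this]

lemma componentLabel_spec {v : V} (hv : v ∉ T) : componentLabel G T v ∉ T ∧
    componentLabel G T (componentLabel G T v) = componentLabel G T v :=
  ⟨componentLabel_notMem hv, (componentLabel_eq_iff (componentLabel_notMem hv) hv).2
    fun h => not_sep_componentLabel hv h.symm⟩

/-- The prime ideal `P_T(G)`: the smallest prime ideal containing the variables of the vertices in
`T` and the minors of the components of `G ∖ T`. -/
noncomputable def cutIdeal (K : Type*) [Field K] (G : SimpleGraph V) (T : Set V) :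
    Ideal (MvPolynomial (V ⊕ V) K) :=
  labelIdeal K (componentLabel G T) T

instance cutIdeal_isPrime : (cutIdeal K G T).IsPrime := labelIdeal_isPrime

lemma minor_mem_cutIdeal {i j : V} : minor K i j ∈ cutIdeal K G T ↔ ¬ Sep G T i j := by
  rw [cutIdeal, minor_mem_labelIdeal]
  by_cases hi : i ∈ T
  · simp [hi, Sep]
  by_cases hj : j ∈ T
  · simp [hj, Sep]
  simp [hi, hj, componentLabel_eq_iff hi hj]

lemma binomialEdgeIdeal_le_iff {I : Ideal (MvPolynomial (V ⊕ V) K)} :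
    binomialEdgeIdeal K G ≤ I ↔ ∀ i j, G.Adj i j → minor K i j ∈ I := by
  rw [binomialEdgeIdeal, Ideal.span_le]
  constructor
  · intro h i j hij
    exact h ⟨i, j, hij, rfl⟩
  · rintro h f ⟨i, j, hij, rfl⟩
    exact h i j hij

lemma binomialEdgeIdeal_le_cutIdeal : binomialEdgeIdeal K G ≤ cutIdeal K G T :=
  binomialEdgeIdeal_le_iff.2 fun _ _ hij => minor_mem_cutIdeal.2 fun h => h.not_adj hij

/-- The set `T` consists of the vertices with both variables in `Q`. Outside `T`, proportionality
modulo `Q` is transitive, so it spreads along edges through each component. -/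
lemma exists_cutIdeal_le {Q : Ideal (MvPolynomial (V ⊕ V) K)} [hQ : Q.IsPrime]
    (h : binomialEdgeIdeal K G ≤ Q) : ∃ T, cutIdeal K G T ≤ Q := by
  rw [binomialEdgeIdeal_le_iff] at h
  refine ⟨{v | X (Sum.inl v) ∈ Q ∧ X (Sum.inr v) ∈ Q}, labelIdeal_le (fun v hv => hv)
    fun i j hi hj hij => ?_⟩
  rw [componentLabel_eq_iff hi hj] at hij
  by_contra hm
  refine hij ⟨hi, hj, {k | ¬ (X (Sum.inl k) ∈ Q ∧ X (Sum.inr k) ∈ Q) ∧ minor K i k ∈ Q},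
    ⟨hi, minor_self (K := K) i ▸ Q.zero_mem⟩, fun h => hm h.2, ?_⟩
  rintro k ⟨hk, hik⟩ l hkl
  by_cases hl : X (Sum.inl l) ∈ Q ∧ X (Sum.inr l) ∈ Q
  · exact Or.inr hl
  · exact Or.inl ⟨hl, minor_mem_trans hk hik (h k l hkl)⟩

lemma subset_of_cutIdeal_le {S : Set V} (h : cutIdeal K G S ≤ cutIdeal K G T) : S ⊆ T :=
  fun _ hv => X_inl_mem_labelIdeal.1 (h (X_inl_mem_labelIdeal.2 hv))

/-- If `t ∈ T` joins no two components, then `P_{T ∖ {t}}` is properly contained in `P_T`.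
Conversely, if `t` joins `b₁` and `b₂`, a prime `P_S` below `P_T` with `t ∉ S` would contain the
minor of `b₁` and `b₂`, which `P_T` does not. -/
lemma mem_minimalPrimes_iff [Finite V] {P : Ideal (MvPolynomial (V ⊕ V) K)} :
    P ∈ (binomialEdgeIdeal K G).minimalPrimes ↔ ∃ T, IsCutset G T ∧ P = cutIdeal K G T := by
  constructor
  · rintro ⟨⟨hP, hle⟩, hmin⟩
    obtain ⟨T, hT⟩ := exists_cutIdeal_le hle
    have hPT : P = cutIdeal K G T :=
      le_antisymm (hmin ⟨cutIdeal_isPrime, binomialEdgeIdeal_le_cutIdeal⟩ hT) hT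
    refine ⟨T, isCutset_iff.2 fun t ht => ?_, hPT⟩
    by_contra hc
    push Not at hc
    have hle' : cutIdeal K G (T \ {t}) ≤ P := by
      rw [hPT]
      refine labelIdeal_le (fun v hv => ⟨X_inl_mem_labelIdeal.2 hv.1, X_inr_mem_labelIdeal.2 hv.1⟩)
        fun i j hi hj hij => ?_
      rw [componentLabel_eq_iff hi hj] at hij
      rw [minor_mem_cutIdeal]
      exact fun hs => hij (hs.sdiff_singleton (fun b₁ b₂ h1 h2 => hc b₁ b₂ h1 h2) ht)
    have hge := hmin ⟨cutIdeal_isPrime, binomialEdgeIdeal_le_cutIdeal⟩ hle'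
    rw [hPT] at hge
    exact (subset_of_cutIdeal_le hge ht).2 rfl
  · rintro ⟨T, hT, rfl⟩
    refine ⟨⟨cutIdeal_isPrime, binomialEdgeIdeal_le_cutIdeal⟩, ?_⟩
    rintro Q ⟨hQ, hQle⟩ hQT
    obtain ⟨S, hS⟩ := exists_cutIdeal_le hQle
    have hST := subset_of_cutIdeal_le (hS.trans hQT)
    have : S = T := by
      refine hST.antisymm fun t ht => ?_
      by_contra htS
      obtain ⟨b₁, b₂, h1, h2, hs⟩ := isCutset_iff.1 hT t ht
      have hm : minor K b₁ b₂ ∈ cutIdeal K G S := by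
        rw [minor_mem_cutIdeal]
        intro hs'
        rcases hs'.or_of_notMem htS with h | h
        · exact h.not_adj h1.symm
        · exact h.not_adj h2
      exact minor_mem_cutIdeal.1 (hQT (hS hm)) hs
    exact this ▸ hS

lemma numComponents_eq_ncard [Finite V] :
    numComponents G T = {v | v ∉ T ∧ componentLabel G T v = v}.ncard := by
  refine le_antisymm (numComponents_le_ncard _ (fun v hv => hv.1) fun x hx => ?_) ?_
  · exact ⟨componentLabel G T x, componentLabel_spec hx, fun h =>
      not_sep_componentLabel hx h.symm⟩
  · rw [← Nat.card_coe_set_eq]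
    refine card_le_numComponents (fun v => v.1) (fun v => v.2.1) fun v w hvw => ?_
    by_contra hs
    rw [← componentLabel_eq_iff v.2.1 w.2.1, v.2.2, w.2.2] at hs
    exact hvw (Subtype.ext hs)

/-- The height is `2|T|` plus the `|V| - |T| - c(T)` vertices that do not represent their component.
The additive form avoids truncated subtraction. -/
lemma exists_height_cutIdeal [Finite V] : ∃ n : ℕ, (cutIdeal K G T).height = n ∧
    n + numComponents G T = Nat.card V + T.ncard := by
  refine ⟨_, height_labelIdeal fun v hv => componentLabel_spec hv, ?_⟩
  rw [numComponents_eq_ncard]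
  have h1 : {v | v ∉ T ∧ componentLabel G T v ≠ v}.ncard +
      {v | v ∉ T ∧ componentLabel G T v = v}.ncard = Tᶜ.ncard := by
    rw [← Set.ncard_union_eq]
    · congr 1
      ext v
      simp only [Set.mem_union, Set.mem_ofPred_eq, Set.mem_compl_iff]
      tauto
    · rw [Set.disjoint_left]
      rintro v hv hv'
      exact hv.2 hv'.2
  have h2 := Set.ncard_add_ncard_compl T
  omega

lemma isCutset_empty : IsCutset G ∅ := fun _ h => h.elim

/-- `J_G` is unmixed if and only if `c_G(T) = |T| + c(G)` for every cutset `T` of `G`. -/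
theorem isUnmixed_binomialEdgeIdeal_iff [Finite V] :
    IsUnmixed (binomialEdgeIdeal K G) ↔
      ∀ T, IsCutset G T → numComponents G T = T.ncard + numComponents G ∅ := by
  obtain ⟨n₀, hn₀, hc₀⟩ := exists_height_cutIdeal (K := K) (G := G) (T := ∅)
  rw [Set.ncard_empty] at hc₀
  constructor
  · intro h T hT
    obtain ⟨n, hn, hc⟩ := exists_height_cutIdeal (K := K) (G := G) (T := T)
    have := h _ (mem_minimalPrimes_iff.2 ⟨T, hT, rfl⟩) _
      (mem_minimalPrimes_iff.2 ⟨∅, isCutset_empty, rfl⟩)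
    rw [hn, hn₀, Nat.cast_inj] at this
    omega
  · intro h P hP Q hQ
    obtain ⟨T, hT, rfl⟩ := mem_minimalPrimes_iff.1 hP
    obtain ⟨S, hS, rfl⟩ := mem_minimalPrimes_iff.1 hQ
    obtain ⟨n, hn, hc⟩ := exists_height_cutIdeal (K := K) (G := G) (T := T)
    obtain ⟨m, hm, hc'⟩ := exists_height_cutIdeal (K := K) (G := G) (T := S)
    have h1 := h T hT
    have h2 := h S hS
    rw [hn, hm, Nat.cast_inj]
    omega

end Unmixed

/-! ### Iterated deletion of vertices -/

section Deletion

variable {V : Type*} {G : SimpleGraph V} {S : Set V} {T : Set ↥Sᶜ}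

lemma Sep.of_deleteSet {a b : ↥Sᶜ} (h : Sep (deleteSet G S) T a b) :
    Sep G (S ∪ Subtype.val '' T) a.1 b.1 := by
  obtain ⟨ha, hb, K, h1, h2, hK⟩ := h
  have hnot : ∀ c : ↥Sᶜ, c ∉ T → c.1 ∉ S ∪ Subtype.val '' T := by
    rintro c hc (h | ⟨d, hd, hdc⟩)
    · exact c.2 h
    · exact hc (Subtype.ext hdc ▸ hd)
  refine ⟨hnot a ha, hnot b hb, Subtype.val '' K, ⟨a, h1, rfl⟩, ?_, ?_⟩
  · rintro ⟨c, hc, hcb⟩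
    exact h2 (Subtype.ext hcb ▸ hc)
  · rintro _ ⟨x, hx, rfl⟩ y hxy
    by_cases hy : y ∈ S
    · exact Or.inr (Or.inl hy)
    · rcases hK x hx ⟨y, hy⟩ hxy with h | h
      · exact Or.inl ⟨_, h, rfl⟩
      · exact Or.inr (Or.inr ⟨_, h, rfl⟩)

lemma numComponents_deleteSet :
    numComponents (deleteSet G S) T = numComponents G (S ∪ Subtype.val '' T) := by
  refine Nat.card_congr (SimpleGraph.Iso.connectedComponentEquiv ⟨⟨fun x => ⟨x.1.1, ?_⟩,
    fun x => ⟨⟨x.1, fun h => x.2 (Or.inl h)⟩, fun h => x.2 (Or.inr ⟨_, h, rfl⟩)⟩,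
    fun _ => rfl, fun _ => rfl⟩, Iff.rfl⟩)
  rintro (h | ⟨d, hd, hdc⟩)
  · exact x.1.2 h
  · exact x.2 (Subtype.ext hdc ▸ hd)

end Deletion

/-! ### Translation between the whiskered graph and `B` -/

section Whiskers

variable {V : Type*} {B : SimpleGraph V} {W : Set V}

lemma withWhiskers_adj_inl_inr {u : V} {w : W} :
    (withWhiskers B W).Adj (Sum.inl u) (Sum.inr w) ↔ u = w := Iff.rfl

lemma withWhiskers_adj_inr {w : W} {z : V ⊕ W} :
    (withWhiskers B W).Adj (Sum.inr w) z ↔ z = Sum.inl w.1 := by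
  rcases z with z | z
  · exact Sum.inl_injective.eq_iff.symm
  · exact ⟨fun h => h.elim, fun h => by cases h⟩

lemma withWhiskers_adj_inl_of_notMem {t : V} (ht : t ∉ W) {z : V ⊕ W}
    (h : (withWhiskers B W).Adj (Sum.inl t) z) : ∃ b, z = Sum.inl b ∧ B.Adj t b := by
  rcases z with b | w
  · exact ⟨b, rfl, h⟩
  · exact (ht (withWhiskers_adj_inl_inr.1 h ▸ w.2)).elim

/-- Two distinct neighbours of a vertex are not both whiskers. -/
lemma exists_inl_of_withWhiskers_adj {t : V} {z₁ z₂ : V ⊕ W} (hne : z₁ ≠ z₂)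
    (h₁ : (withWhiskers B W).Adj (Sum.inl t) z₁) (h₂ : (withWhiskers B W).Adj (Sum.inl t) z₂) :
    ∃ b, (z₁ = Sum.inl b ∨ z₂ = Sum.inl b) ∧ B.Adj t b := by
  rcases z₁ with b | w₁
  · exact ⟨b, Or.inl rfl, h₁⟩
  rcases z₂ with b | w₂
  · exact ⟨b, Or.inr rfl, h₂⟩
  · refine (hne (congrArg Sum.inr (Subtype.ext ?_))).elim
    exact (withWhiskers_adj_inl_inr.1 h₁).symm.trans (withWhiskers_adj_inl_inr.1 h₂)

lemma sep_inr {T : Set (V ⊕ W)} {w : W} (hw : Sum.inl w.1 ∈ T) (hwT : Sum.inr w ∉ T)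
    {z : V ⊕ W} (hz : z ∉ T) (hzw : z ≠ Sum.inr w) : Sep (withWhiskers B W) T (Sum.inr w) z := by
  refine ⟨hwT, hz, {Sum.inr w}, rfl, hzw, ?_⟩
  rintro _ rfl y hy
  exact Or.inr (withWhiskers_adj_inr.1 hy ▸ hw)

lemma sep_withWhiskers_iff {T : Set V} {a b : V} :
    Sep (withWhiskers B W) (Sum.inl '' T) (Sum.inl a) (Sum.inl b) ↔ Sep B T a b := by
  constructor
  · rintro ⟨ha, hb, K, h1, h2, hK⟩
    refine ⟨fun h => ha ⟨a, h, rfl⟩, fun h => hb ⟨b, h, rfl⟩, Sum.inl ⁻¹' K, h1, h2, ?_⟩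
    intro x hx y hxy
    refine (hK _ hx (Sum.inl y) hxy).imp id ?_
    rintro ⟨y', hy', he⟩
    exact Sum.inl_injective he ▸ hy'
  · rintro ⟨ha, hb, K, h1, h2, hK⟩
    refine ⟨by simpa using ha, by simpa using hb, {z | Sum.elim id Subtype.val z ∈ K}, h1, h2, ?_⟩
    rintro (x | w) hx (y | w') hxy
    · exact (hK x hx y hxy).imp id fun h => ⟨y, h, rfl⟩
    · exact Or.inl (show w'.1 ∈ K from withWhiskers_adj_inl_inr.1 hxy ▸ hx)
    · exact Or.inl (show y ∈ K from Sum.inl_injective (withWhiskers_adj_inr.1 hxy) ▸ hx)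
    · exact hxy.elim

/-- Each deleted vertex of `W` leaves its whisker end isolated; all other whisker ends belong to the
component of their attachment vertex. -/
lemma numComponents_withWhiskers [Finite V] (T : Set V) :
    numComponents (withWhiskers B W) (Sum.inl '' T) = numComponents B T + (T ∩ W).ncard := by
  let f : {v | v ∉ T ∧ componentLabel B T v = v} ⊕ ↥(T ∩ W) → V ⊕ W :=
    Sum.elim (fun v => Sum.inl v.1) (fun w => Sum.inr ⟨w.1, w.2.2⟩)
  have hf : ∀ i, f i ∉ (Sum.inl '' T : Set (V ⊕ W)) := by
    rintro (v | w)
    · simpa [f] using v.2.1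
    · simp [f]
  have hcard : Nat.card ({v | v ∉ T ∧ componentLabel B T v = v} ⊕ ↥(T ∩ W)) =
      numComponents B T + (T ∩ W).ncard := by
    rw [Nat.card_sum, Nat.card_coe_set_eq, Nat.card_coe_set_eq, numComponents_eq_ncard]
  rw [← hcard]
  refine le_antisymm (numComponents_le_card f hf fun x hx => ?_)
    (card_le_numComponents f hf fun i j hij => ?_)
  · have hrep : ∀ v, v ∉ T → ∃ i, ¬ Sep (withWhiskers B W) (Sum.inl '' T) (f i) (Sum.inl v) := by
      intro v hv
      refine ⟨Sum.inl ⟨_, componentLabel_spec (G := B) hv⟩, fun h => ?_⟩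
      exact not_sep_componentLabel hv (sep_withWhiskers_iff.1 h).symm
    rcases x with v | w
    · exact hrep v fun h => hx ⟨v, h, rfl⟩
    · by_cases hw : w.1 ∈ T
      · exact ⟨Sum.inr ⟨w.1, hw, w.2⟩, not_sep_self _⟩
      · obtain ⟨i, hi⟩ := hrep w.1 hw
        refine ⟨i, fun h => ?_⟩
        rcases h.or_of_notMem (c := Sum.inl w.1) (by simpa using hw) with h1 | h1
        · exact hi h1
        · exact h1.not_adj (withWhiskers_adj_inl_inr.2 rfl)
  · have hsep : ∀ (w : ↥(T ∩ W)) i, i ≠ Sum.inr w →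
        Sep (withWhiskers B W) (Sum.inl '' T) (f (Sum.inr w)) (f i) := by
      intro w i hi
      refine sep_inr (T := Sum.inl '' T) (w := ⟨w.1, w.2.2⟩) ⟨_, w.2.1, rfl⟩ (by simp) (hf i) fun h => hi ?_
      rcases i with v | w'
      · simp [f] at h
      · simpa [f, Subtype.ext_iff] using h
    rcases i with v | w
    · rcases j with v' | w'
      · refine sep_withWhiskers_iff.2 ?_
        by_contra hs
        rw [← componentLabel_eq_iff v.2.1 v'.2.1, v.2.2, v'.2.2] at hs
        exact hij (congrArg Sum.inl (Subtype.ext hs))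
      · exact (hsep w' _ hij).symm
    · exact hsep w _ hij.symm

/-- A vertex of `W` always has its whisker end as one of the two separated neighbours, so a single
surviving neighbour in `B` suffices. -/
lemma isCutset_withWhiskers_iff [Finite V] {T : Set V} :
    IsCutset (withWhiskers B W) (Sum.inl '' T) ↔ IsWhiskerCutset B W T := by
  rw [isCutset_iff]
  constructor
  · intro h t ht
    obtain ⟨z₁, z₂, h1, h2, hs⟩ := h _ ⟨t, ht, rfl⟩
    refine ⟨fun _ => ?_, fun htW => ?_⟩
    · obtain ⟨b, hb, htb⟩ := exists_inl_of_withWhiskers_adj hs.ne h1 h2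
      refine ⟨b, fun hbT => ?_, htb⟩
      rcases hb with rfl | rfl
      · exact hs.1 ⟨b, hbT, rfl⟩
      · exact hs.2.1 ⟨b, hbT, rfl⟩
    · obtain ⟨b₁, rfl, hb₁⟩ := withWhiskers_adj_inl_of_notMem htW h1
      obtain ⟨b₂, rfl, hb₂⟩ := withWhiskers_adj_inl_of_notMem htW h2
      exact ⟨b₁, b₂, hb₁, hb₂, sep_withWhiskers_iff.1 hs⟩
  · rintro h _ ⟨t, ht, rfl⟩
    by_cases htW : t ∈ W
    · obtain ⟨b, hb, htb⟩ := (h t ht).1 htW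
      refine ⟨Sum.inr ⟨t, htW⟩, Sum.inl b, rfl, htb, sep_inr (T := Sum.inl '' T) (w := ⟨t, htW⟩) ⟨t, ht, rfl⟩ (by simp)
        (by simpa using hb) (by simp)⟩
    · obtain ⟨b₁, b₂, hb₁, hb₂, hs⟩ := (h t ht).2 htW
      exact ⟨Sum.inl b₁, Sum.inl b₂, hb₁, hb₂, sep_withWhiskers_iff.2 hs⟩

lemma isAccessibleBlock_of_isAccessible {K : Type*} [Field K] [Finite V] (hconn : B.Connected)
    (hcut : ∀ v, ¬ IsCutVertex B v) (hacc : IsAccessible K (withWhiskers B W)) :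
    IsAccessibleBlock B W where
  conn a b h := by
    have h1 := two_le_numComponents h
    rw [numComponents_empty_of_connected hconn] at h1
    omega
  noCut v a b h := by
    have h1 := two_le_numComponents h
    refine hcut v ?_
    have h2 := numComponents_empty_of_connected hconn
    rw [numComponents_empty] at h2
    rw [IsCutVertex, h2]
    exact h1
  unmixed T hT := by
    have h1 := isUnmixed_binomialEdgeIdeal_iff.1 hacc.1 _ (isCutset_withWhiskers_iff.2 hT)
    have h2 := numComponents_withWhiskers (B := B) (W := W) T
    have h3 := numComponents_withWhiskers (B := B) (W := W) ∅
    rw [Set.image_empty, Set.empty_inter, Set.ncard_empty,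
      numComponents_empty_of_connected hconn] at h3
    rw [Set.ncard_image_of_injective _ Sum.inl_injective] at h1
    have h4 := Set.ncard_inter_add_ncard_sdiff_eq_ncard T W
    omega
  acc T hT hne := by
    obtain ⟨_, ⟨t, ht, rfl⟩, hc⟩ := hacc.2 _ (isCutset_withWhiskers_iff.2 hT) (hne.image _)
    refine ⟨t, ht, isCutset_withWhiskers_iff.1 ?_⟩
    rwa [Set.image_sdiff Sum.inl_injective, Set.image_singleton]

namespace IsAccessibleBlock

variable [Finite V] (h : IsAccessibleBlock B W)
include h

lemma isCutVertex_inl (hW : W.Nontrivial) {w : V} (hw : w ∈ W) :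
    IsCutVertex (withWhiskers B W) (Sum.inl w) := by
  obtain ⟨b, -, hb⟩ := h.exists_adj_mem hW w
  exact isCutVertex_iff.2 ⟨Sum.inr ⟨w, hw⟩, Sum.inl b, rfl, hb,
    sep_inr (T := {Sum.inl w}) (w := ⟨w, hw⟩) rfl (by simp) (by simpa using hb.ne') (by simp)⟩

lemma mem_of_isCutVertex {v : V ⊕ W} (hv : IsCutVertex (withWhiskers B W) v) :
    v ∈ (Sum.inl '' W : Set (V ⊕ W)) := by
  obtain ⟨z₁, z₂, h1, h2, hs⟩ := isCutVertex_iff.1 hv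
  rcases v with x | w
  · by_contra hx
    have hxW : x ∉ W := fun h => hx ⟨x, h, rfl⟩
    obtain ⟨b₁, rfl, hb₁⟩ := withWhiskers_adj_inl_of_notMem hxW h1
    obtain ⟨b₂, rfl, hb₂⟩ := withWhiskers_adj_inl_of_notMem hxW h2
    rw [← Set.image_singleton, sep_withWhiskers_iff] at hs
    exact h.noCut _ _ _ hs
  · exact (hs.ne ((withWhiskers_adj_inr.1 h1).trans (withWhiskers_adj_inr.1 h2).symm)).elim

/-- Cut vertices lie in `W`, so `W` has at least three elements. Then each of its vertices has a
neighbour in `B` besides its whisker and is itself a cut vertex. -/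
lemma ncard_eq_three (hcut : {v | IsCutVertex (withWhiskers B W) v}.ncard = 3) : W.ncard = 3 := by
  have hsub : {v | IsCutVertex (withWhiskers B W) v} ⊆ Sum.inl '' W :=
    fun v hv => h.mem_of_isCutVertex hv
  have h1 := Set.ncard_le_ncard hsub (Set.toFinite _)
  rw [Set.ncard_image_of_injective _ Sum.inl_injective, hcut] at h1
  have hW : W.Nontrivial := Set.one_lt_ncard_iff_nontrivial.1 (by omega)
  have heq : {v | IsCutVertex (withWhiskers B W) v} = Sum.inl '' W := by
    refine hsub.antisymm ?_
    rintro _ ⟨w, hw, rfl⟩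
    exact h.isCutVertex_inl hW hw
  rw [← hcut, heq, Set.ncard_image_of_injective _ Sum.inl_injective]

end IsAccessibleBlock

/-- If no obstruction exists for `w`, then deleting `w` from the graph with whiskers preserves
unmixedness. -/
lemma isUnmixed_deleteSet {K : Type*} [Field K] [Finite V]
    (hH : IsUnmixed (binomialEdgeIdeal K (withWhiskers B W)))
    {w : V} (hw : w ∈ W) (hcutw : IsCutVertex (withWhiskers B W) (Sum.inl w))
    (hobs : ∀ S, ¬ IsObstruction B W w S) :
    IsUnmixed (binomialEdgeIdeal K (deleteSet (withWhiskers B W) {Sum.inl w})) := by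
  rw [isUnmixed_binomialEdgeIdeal_iff] at hH ⊢
  intro T hT
  rw [isCutset_iff] at hT
  have hempty : IsCutset (withWhiskers B W) {Sum.inl w} := by
    rw [isCutset_iff]
    rintro _ rfl
    exact isCutVertex_iff.1 hcutw
  have hleaf : ∀ (w' : W) (hw' : Sum.inr w' ∈ ({Sum.inl w}ᶜ : Set (V ⊕ W))),
      (⟨Sum.inr w', hw'⟩ : ↥({Sum.inl w}ᶜ : Set (V ⊕ W))) ∉ T := by
    intro w' hw' hmem
    obtain ⟨c₁, c₂, h1, h2, hs⟩ := hT _ hmem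
    exact hs.ne (Subtype.ext
      ((withWhiskers_adj_inr.1 h1).trans (withWhiskers_adj_inr.1 h2).symm))
  set T' : Set (V ⊕ W) := {Sum.inl w} ∪ Subtype.val '' T with hT'
  have hwT' : Sum.inl w ∈ T' := Or.inl rfl
  have hmemT' : ∀ z (hz : z ∈ ({Sum.inl w}ᶜ : Set (V ⊕ W))), z ∈ T' → ⟨z, hz⟩ ∈ T := by
    rintro z hz (h | ⟨c, hc, rfl⟩)
    · exact (hz h).elim
    · exact hc
  -- If `w` keeps a neighbour `b`, then `T'` is a cutset of the whiskered graph, and comparing its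
  -- count with that of `{w}` gives the formula for `T`. Otherwise `T'` contains all neighbours of
  -- `w` in `B`, and its trace on `B` without `w` is an obstruction.
  by_cases hex : ∃ b, B.Adj w b ∧ Sum.inl b ∉ T'
  · obtain ⟨b, hwb, hb⟩ := hex
    have hcut : IsCutset (withWhiskers B W) T' := by
      rw [isCutset_iff]
      rintro t (rfl | ⟨c, hc, rfl⟩)
      · refine ⟨Sum.inr ⟨w, hw⟩, Sum.inl b, rfl, hwb, sep_inr hwT' (fun h => ?_) hb (by simp)⟩
        exact hleaf _ (by simp) (hmemT' _ (by simp) h)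
      · obtain ⟨c₁, c₂, h1, h2, hs⟩ := hT c hc
        exact ⟨c₁.1, c₂.1, h1, h2, hs.of_deleteSet⟩
    have hcard : T'.ncard = T.ncard + 1 := by
      rw [hT', Set.singleton_union, Set.ncard_insert_of_notMem,
        Set.ncard_image_of_injective _ Subtype.val_injective]
      rintro ⟨c, -, hc⟩
      exact c.2 hc
    have h1 := hH _ hcut
    have h2 := hH _ hempty
    rw [numComponents_deleteSet, numComponents_deleteSet, Set.image_empty, Set.union_empty, h2,
      ← hT', h1, hcard, Set.ncard_singleton]
    ring
  · push Not at hex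
    have hwS : w ∉ {x | x ≠ w ∧ (Sum.inl x : V ⊕ W) ∈ T'} := fun h => h.1 rfl
    have hdata : ∀ t ∈ {x | x ≠ w ∧ (Sum.inl x : V ⊕ W) ∈ T'}, ∃ z₁ z₂,
        (withWhiskers B W).Adj (Sum.inl t) z₁ ∧ (withWhiskers B W).Adj (Sum.inl t) z₂ ∧
          Sep (withWhiskers B W) T' z₁ z₂ := by
      rintro t ⟨htw, ht⟩
      obtain ⟨c₁, c₂, h1, h2, hs⟩ := hT _ (hmemT' _ (by simpa using htw) ht)
      exact ⟨c₁.1, c₂.1, h1, h2, hs.of_deleteSet⟩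
    have hne : ∀ x, (Sum.inl x : V ⊕ W) ∉ T' → x ≠ w := by
      rintro x hx rfl
      exact hx hwT'
    refine (hobs {x | x ≠ w ∧ (Sum.inl x : V ⊕ W) ∈ T'} ⟨hwS, fun x hx => ⟨hx.ne', hex x hx⟩,
      fun t ht _ => ?_, fun t ht htW => ?_⟩).elim
    · obtain ⟨z₁, z₂, h1, h2, hs⟩ := hdata t ht
      obtain ⟨b, hb, htb⟩ := exists_inl_of_withWhiskers_adj hs.ne h1 h2
      have hbT : (Sum.inl b : V ⊕ W) ∉ T' := by
        rcases hb with rfl | rfl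
        · exact hs.1
        · exact hs.2.1
      exact ⟨b, fun h => hbT h.2, hne b hbT, htb⟩
    · obtain ⟨z₁, z₂, h1, h2, hs⟩ := hdata t ht
      obtain ⟨b₁, rfl, hb₁⟩ := withWhiskers_adj_inl_of_notMem htW h1
      obtain ⟨b₂, rfl, hb₂⟩ := withWhiskers_adj_inl_of_notMem htW h2
      refine ⟨b₁, b₂, hne _ hs.1, hne _ hs.2.1, hb₁, hb₂, fun h => hs.1 h.2, fun h => hs.2.1 h.2, ?_⟩
      obtain ⟨g1, g2, L, l1, l2, l3⟩ := hs
      refine ⟨{x | Sum.inl x ∈ L ∧ Sum.inl x ∉ T'}, ⟨l1, g1⟩, fun h => l2 h.1, ?_⟩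
      rintro x ⟨hxL, hxT⟩ y hxy
      by_cases hyT : (Sum.inl y : V ⊕ W) ∈ T'
      · refine Or.inr ⟨?_, hyT⟩
        rintro rfl
        exact hxT (hex x hxy.symm)
      · exact Or.inl ⟨(l3 _ hxL (Sum.inl y) hxy).resolve_right hyT, hyT⟩

end Whiskers

end BinomialEdge

theorem mainTheorem8 (K : Type*) [Field K] {V : Type*} [Finite V] (G : SimpleGraph V)
    (S : Set V) (hS : BinomialEdge.IsBlock G S) (W : Set ↥S)
    (hacc : BinomialEdge.IsAccessible K (BinomialEdge.withWhiskers (G.induce S) W))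
    (hcut : {v | BinomialEdge.IsCutVertex
      (BinomialEdge.withWhiskers (G.induce S) W) v}.ncard = 3) :
    ∃ v, BinomialEdge.IsCutVertex (BinomialEdge.withWhiskers (G.induce S) W) v ∧
      BinomialEdge.IsUnmixed (BinomialEdge.binomialEdgeIdeal K
        (BinomialEdge.deleteSet (BinomialEdge.withWhiskers (G.induce S) W) {v})) := by
  have h := BinomialEdge.isAccessibleBlock_of_isAccessible hS.prop.1 hS.prop.2 hacc
  have hW := h.ncard_eq_three hcut
  obtain ⟨w, hw, hobs⟩ := h.exists_forall_not_isObstruction hW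
  have hcutw := h.isCutVertex_inl
    (Set.one_lt_ncard_iff_nontrivial.1 (by omega)) hw
  exact ⟨Sum.inl w, hcutw, BinomialEdge.isUnmixed_deleteSet hacc.1 hw hcutw hobs⟩
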